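/- Let $\mathbb{T}\subseteq\mathbb{R}$ be a time scale (a nonempty closed set), $a,b\in\mathbb{T}$ with $a\le b$, and $\mathbb{T}_*=[a,b]\cap\mathbb{T}$, regarded as a time scale with forward and backward jump operators $\sigma(t)=\inf\{s\in\mathbb{T}_*:s>t\}$, $\rho(t)=\sup\{s\in\mathbb{T}_*:s<t\}$ (with $\inf\emptyset=\max\mathbb{T}_*$, $\sup\emptyset=\min\mathbb{T}_*$). A point $t$ is right-dense if $\sigma(t)=t$ and left-dense if $\rho(t)=t$; for a time scale $S$, $S^\kappa$ is the set of points of $S$ that are non-maximal or left-dense in $S$, and $S^{\kappa^2}=(S^\kappa)^\kappa$. A function is rd-continuous if it is continuous at right-dense points and has finite left-sided limits at left-dense points. The $\Delta$-derivative of $F$ at $t$ is the number $F^\Delta(t)$ such that for every $\varepsilon>0$ there is $\delta>0$ with $|F(\sigma(t))-F(s)-F^\Delta(t)(\sigma(t)-s)|\le\varepsilon|\sigma(t)-s|$ for all $s\in\mathbb{T}_*$, $|s-t|<\delta$. The $\Delta$-integral is $\int_s^r g(t)\,\Delta t=F(r)-F(s)$ for an antiderivative $F$ of $g$ (that is, $F^\Delta=g$),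 and $e_f(\cdot,t_0)$ is the solution on $\mathbb{T}_*$ of $y^\Delta=f(t)y$, $y(t_0)=1$. Let $u:\mathbb{T}_*\to[0,\infty)$ and $f:\mathbb{T}_*^\kappa\to[0,\infty)$ be rd-continuous, and let $A:\mathbb{T}_*\to(0,\infty)$ be rd-continuous and nondecreasing. Let $k:\mathbb{T}_*\times\mathbb{T}_*\to\mathbb{R}$ be such that for every $t\in\mathbb{T}_*^\kappa$ with $t>a$: $k$ is continuous at $(t,t)$; $k(t,\cdot)$ is rd-continuous on $[a,\sigma(t)]\cap\mathbb{T}$; and $k$ has a $\Delta$-derivative $k^{\Delta_1}(t,\tau)$ in its first variable at $t$, uniformly in $\tau$, i.e. for every $\varepsilon>0$ there is $\delta>0$ such that $|k(\sigma(t),\tau)-k(s,\tau)-k^{\Delta_1}(t,\tau)(\sigma(t)-s)|\le\varepsilon|\sigma(t)-s|$ for all $s\in\mathbb{T}_*$ with $|s-t|<\delta$ and all $\tau\in[a,\sigma(t)]\cap\mathbb{T}$. Assume that $k(t,s)\ge0$ for all $s\le t$ in $\mathbb{T}_*$, that $k^{\Delta_1}(t,s)\ge0$ for all $t\in\mathbb{T}_*^\kappa$,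 $t>a$, and $s\in\mathbb{T}_*$, $s\le t$, and that $k$ is not identically zero on $\mathbb{T}_*^\kappa\times\mathbb{T}_*^{\kappa^2}$. Let $\Phi,W:[0,\infty)\to[0,\infty)$ be continuous and nondecreasing, with $\Phi(x)>0$ and $W(x)>0$ for $x>0$, and let $\Phi$ be subadditive, $\Phi(x+y)\le\Phi(x)+\Phi(y)$, and submultiplicative, $\Phi(xy)\le\Phi(x)\Phi(y)$. Fix $x_0>0$ and put $$p(t)=1+\int_a^t f(s)\,e_f(t,\sigma(s))\,\Delta s,\qquad \zeta=\int_a^{\rho(b)}k(\rho(b),s)\,\Phi(p(s)A(s))\,\Delta s,$$ $$\Psi(x)=\int_{x_0}^x\frac{ds}{\Phi(W(s))}\quad(x>0),\qquad I(s)=\int_a^s k(s,\tau)\,\Phi(p(\tau))\,\Phi\Big(\int_a^\tau f(\theta)\,\Delta\theta\Big)\Delta\tau .$$ Let $\Psi^{-1}$ be the inverse of $\Psi:(0,\infty)\to\mathbb{R}$, with domain $\operatorname{Dom}(\Psi^{-1})=\Psi((0,\infty))$. (In degenerate cases $\zeta$ may be $0$; then $\Psi(0)$ means $\int_{x_0}^0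 ds/\Phi(W(s))$ if this integral converges, and $0$ otherwise.) If $$u(t)\le A(t)+\int_a^t f(s)u(s)\,\Delta s+\int_a^t f(s)\,W\Big(\int_a^s k(s,\tau)\,\Phi(u(\tau))\,\Delta\tau\Big)\Delta s\qquad\text{for all }t\in\mathbb{T}_*,$$ then for every $t\in\mathbb{T}_*$ with $\Psi(\zeta)+I(\rho(t))\in\operatorname{Dom}(\Psi^{-1})$, $$u(t)\le p(t)A(t)+p(t)\int_a^t f(s)\,W\big[\Psi^{-1}\big(\Psi(\zeta)+I(s)\big)\big]\Delta s .$$ -/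

import Mathlib

open Set Filter Topology

namespace TimeScale

/-- The time scales interval `[a,b]_T = {t ∈ T : a ≤ t ≤ b}`. -/
def interval (T : Set ℝ) (a b : ℝ) : Set ℝ := T ∩ Icc a b

open Classical in
/-- Forward jump operator `σ(t) = inf {s ∈ T : s > t}`, with `inf ∅ = sup T`. -/
noncomputable def sigma (T : Set ℝ) (t : ℝ) : ℝ :=
  if (T ∩ Ioi t).Nonempty then sInf (T ∩ Ioi t) else sSup T

open Classical in
/-- Backward jump operator `ρ(t) = sup {s ∈ T : s < t}`, with `sup ∅ = inf T`. -/
noncomputable def rho (T : Set ℝ) (t : ℝ) : ℝ :=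
  if (T ∩ Iio t).Nonempty then sSup (T ∩ Iio t) else sInf T

/-- `T^κ`: the points of `T` that are non-maximal or left-dense. -/
def kappa (T : Set ℝ) : Set ℝ := {t ∈ T | ¬ IsGreatest T t ∨ rho T t = t}

/-- `d` is the `Δ`-derivative of `F : T → ℝ` at `t`. -/
def HasDeltaDerivAt (T : Set ℝ) (F : ℝ → ℝ) (d t : ℝ) : Prop :=
  ∀ ε > 0, ∃ δ > 0, ∀ s ∈ T, |s - t| < δ →
    |F (sigma T t) - F s - d * (sigma T t - s)| ≤ ε * |sigma T t - s|

/-- `g : S → ℝ` (with `S ⊆ T`) is rd-continuous: continuous at right-dense points, with finite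
left-sided limits at left-dense points. Points are classified in the time scale `T`. -/
def RdContinuousOn (T S : Set ℝ) (g : ℝ → ℝ) : Prop :=
  (∀ t ∈ S, sigma T t = t → ContinuousWithinAt g S t) ∧
  (∀ t ∈ S, rho T t = t → ∃ l : ℝ, Tendsto g (𝓝[S ∩ Iio t] t) (𝓝 l))

/-- `F` is an antiderivative of `g` between `s` and `r`: `F` is continuous on the time scales
interval with end points `s, r`, and `F^Δ = g` at all its points other than the right end point
(at which the value of `g` plays no role). -/
def IsAntiderivBetween (T : Set ℝ) (F g : ℝ → ℝ) (s r : ℝ) : Prop :=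
  ContinuousOn F (interval T (min s r) (max s r)) ∧
  ∀ t ∈ interval T (min s r) (max s r), t < max s r →
    HasDeltaDerivAt (interval T (min s r) (max s r)) F (g t) t

open Classical in
/-- The `Δ`-integral `∫_s^r g(t) Δt = F(r) - F(s)`, where `F` is an antiderivative of `g`
(and `0` if there is none). -/
noncomputable def integral (T : Set ℝ) (g : ℝ → ℝ) (s r : ℝ) : ℝ :=
  if h : ∃ F : ℝ → ℝ, IsAntiderivBetween T F g s r then h.choose r - h.choose s else 0

/-- `y` solves `y^Δ = q(t) y` on `T`, `y(t₀) = 1`. -/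
def IsExpSolution (T : Set ℝ) (q : ℝ → ℝ) (t₀ : ℝ) (y : ℝ → ℝ) : Prop :=
  (∀ t ∈ kappa T, HasDeltaDerivAt T y (q t * y t) t) ∧ y t₀ = 1

open Classical in
/-- The time scales exponential `e_q(t, t₀)`: the value at `t` of the solution of
`y^Δ = q y`, `y(t₀) = 1`. -/
noncomputable def exp (T : Set ℝ) (q : ℝ → ℝ) (t t₀ : ℝ) : ℝ :=
  if h : ∃ y : ℝ → ℝ, IsExpSolution T q t₀ y then h.choose t else 0

/-- The regularity of a kernel `k : T × T → ℝ` under which `∫_{t₀}^t k(t,τ) Δτ` is differentiated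
under the integral sign: for all `t ∈ T^κ` with `t > t₀`, `k` is continuous at `(t,t)`, `k(t,·)` is
rd-continuous on `[t₀,σ(t)]_T`, and `kΔ(t,τ)` is the `Δ`-derivative of `k` in its first variable
at `t`, uniformly in `τ ∈ [t₀,σ(t)]_T`. -/
structure IsDeltaKernel (T : Set ℝ) (t₀ : ℝ) (k kΔ : ℝ → ℝ → ℝ) : Prop where
  continuous_diag : ∀ t ∈ kappa T, t₀ < t →
    ContinuousWithinAt (fun x : ℝ × ℝ => k x.1 x.2) (T ×ˢ T) (t, t)
  rdContinuous : ∀ t ∈ kappa T, t₀ < t →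
    RdContinuousOn T (interval T t₀ (sigma T t)) (k t)
  deriv_fst : ∀ t ∈ kappa T, t₀ < t → ∀ ε > 0, ∃ δ > 0, ∀ s ∈ T, |s - t| < δ →
    ∀ τ ∈ interval T t₀ (sigma T t),
      |k (sigma T t) τ - k s τ - kΔ t τ * (sigma T t - s)| ≤ ε * |sigma T t - s|

/-- `p(t) = 1 + ∫_a^t f(s) e_f(t,σ(s)) Δs`. -/
noncomputable def pFun (T : Set ℝ) (a : ℝ) (f : ℝ → ℝ) (t : ℝ) : ℝ :=
  1 + integral T (fun s => f s * exp T f t (sigma T s)) a t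

/-- `ζ = ∫_a^{ρ(b)} k(ρ(b),s) Φ(p(s) A(s)) Δs`. -/
noncomputable def zeta (T : Set ℝ) (a b : ℝ) (f A Φ : ℝ → ℝ) (k : ℝ → ℝ → ℝ) : ℝ :=
  integral T (fun s => k (rho T b) s * Φ (pFun T a f s * A s)) a (rho T b)

/-- `∫_a^s k(s,τ) Φ(p(τ)) Φ(∫_a^τ f(θ) Δθ) Δτ`. -/
noncomputable def kernelTerm (T : Set ℝ) (a : ℝ) (f Φ : ℝ → ℝ) (k : ℝ → ℝ → ℝ) (s : ℝ) : ℝ :=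
  integral T (fun τ => k s τ * Φ (pFun T a f τ) * Φ (integral T f a τ)) a s

/-- `Ψ(x) = ∫_{x₀}^x ds / Φ(W(s))`, considered for `x > 0`. -/
noncomputable def Psi (Φ W : ℝ → ℝ) (x₀ x : ℝ) : ℝ := ∫ s in x₀..x, 1 / Φ (W s)

/-- The domain of `Ψ⁻¹`: the range of `Ψ` on `(0,∞)`. -/
def domPsiInv (Φ W : ℝ → ℝ) (x₀ : ℝ) : Set ℝ := Psi Φ W x₀ '' Ioi 0

/-- The inverse of `Ψ : (0,∞) → ℝ`. -/
noncomputable def PsiInv (Φ W : ℝ → ℝ) (x₀ : ℝ) : ℝ → ℝ :=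
  Function.invFunOn (Psi Φ W x₀) (Ioi 0)

end TimeScale

/-! Write `g(t) = ∫_a^t k(t,τ) Φ(u(τ)) Δτ`, `D(t) = ∫_a^t f W(g) Δs` and `F(t) = ∫_a^t f Δs`. Since
`A + D` is nondecreasing, its value at `t` can play the constant in Grönwall's inequality on
`[a,t]`, which gives `u ≤ p (A + D)`; here `p` is the exponential of `f` based at `a`. Because `g`
is nondecreasing, `D ≤ W(g) F` on `T^κ`, and the two functional inequalities for `Φ` yield `Φ(u) ≤
Φ(pA) + Φ(p) Φ(F) Φ(W(g))`. Integrating against `k` gives `g ≤ v`, where `v(t) = ζ + ∫_a^t k(t,τ)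
Φ(p) Φ(F) Φ(W(g)) Δτ`. A Bihari argument then shows `Ψ(v) ≤ Ψ(ζ) + I`, so that `g ≤ Ψ⁻¹(Ψ(ζ) + I)`;
inserting this into `D` finishes the proof.

Two devices carry the analysis. An rd-continuous `g` is integrated as the Lebesgue integral of `g ∘
proj`, where `proj x` is the last point of the time scale not exceeding `x`; this supplies
antiderivatives, linearity, monotonicity and dominated convergence (`IsScale.integral_eq`). Volterra
integrals are never differentiated: `kΔ ≥ 0` makes them nondecreasing in the upper variable
(`volterra_le_volterra`), and `IsScale.bihari` needs only a comparison of increments. -/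

namespace TimeScale

/-! ### Compact time scales, jump operators and the projection -/

/-- `T` is a compact time scale with minimum `a` and maximum `b`. -/
structure IsScale (T : Set ℝ) (a b : ℝ) : Prop where
  closed : IsClosed T
  least : IsLeast T a
  greatest : IsGreatest T b

/-- The last point of `T` not exceeding `x`. -/
noncomputable def proj (T : Set ℝ) (x : ℝ) : ℝ := sSup (T ∩ Iic x)

variable {T : Set ℝ} {a b : ℝ}

theorem sigma_eq_sInf {t r : ℝ} (hr : r ∈ T) (htr : t < r) :
    sigma T t = sInf (T ∩ Ioi t) := if_pos ⟨r, hr, htr⟩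

theorem sigma_le {t r : ℝ} (hr : r ∈ T) (htr : t < r) : sigma T t ≤ r := by
  rw [sigma_eq_sInf hr htr]
  exact csInf_le ⟨t, fun x hx => hx.2.le⟩ ⟨hr, htr⟩

theorem rho_eq_sSup {t r : ℝ} (hr : r ∈ T) (hrt : r < t) :
    rho T t = sSup (T ∩ Iio t) := if_pos ⟨r, hr, hrt⟩

theorem le_rho {t r : ℝ} (hr : r ∈ T) (hrt : r < t) : r ≤ rho T t := by
  rw [rho_eq_sSup hr hrt]
  exact le_csSup ⟨t, fun x hx => hx.2.le⟩ ⟨hr, hrt⟩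

theorem sigma_interval {s r t : ℝ} (hr : r ∈ T) (hst : s ≤ t) (htr : t < r) :
    sigma (interval T s r) t = sigma T t := by
  have hr' : r ∈ interval T s r := ⟨hr, hst.trans htr.le, le_rfl⟩
  refine le_antisymm ?_ ?_
  · rw [sigma_eq_sInf hr htr]
    refine le_csInf ⟨r, hr, htr⟩ fun x hx => ?_
    rcases le_or_gt x r with h | h
    · exact sigma_le ⟨hx.1, hst.trans hx.2.le, h⟩ hx.2
    · exact (sigma_le hr' htr).trans h.le
  · rw [sigma_eq_sInf hr' htr]
    exact le_csInf ⟨r, hr', htr⟩ fun x hx => sigma_le hx.1.1 hx.2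

theorem le_proj {x s : ℝ} (hs : s ∈ T) (hsx : s ≤ x) : s ≤ proj T x :=
  le_csSup ⟨x, fun _ h => h.2⟩ ⟨hs, hsx⟩

namespace IsScale

theorem le (hT : IsScale T a b) : a ≤ b := hT.least.2 hT.greatest.1

theorem isCompact (hT : IsScale T a b) : IsCompact T :=
  isCompact_Icc.of_isClosed_subset hT.closed fun _ hx => ⟨hT.least.2 hx, hT.greatest.2 hx⟩

theorem sigma_greatest (hT : IsScale T a b) : sigma T b = b := by
  rw [sigma, if_neg, hT.greatest.csSup_eq]
  rintro ⟨x, hx, hbx⟩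
  exact (hT.greatest.2 hx).not_gt hbx

theorem rho_least (hT : IsScale T a b) : rho T a = a := by
  rw [rho, if_neg, hT.least.csInf_eq]
  rintro ⟨x, hx, hxa⟩
  exact (hT.least.2 hx).not_gt hxa

theorem le_sigma (hT : IsScale T a b) {t : ℝ} (ht : t ∈ T) : t ≤ sigma T t := by
  rcases (hT.greatest.2 ht).eq_or_lt with rfl | h
  · exact hT.sigma_greatest.ge
  · rw [sigma_eq_sInf hT.greatest.1 h]
    exact le_csInf ⟨b, hT.greatest.1, h⟩ fun x hx => hx.2.le

theorem sigma_mem (hT : IsScale T a b) {t : ℝ} (ht : t ∈ T) : sigma T t ∈ T := by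
  rcases (hT.greatest.2 ht).eq_or_lt with rfl | h
  · rwa [hT.sigma_greatest]
  · rw [sigma_eq_sInf hT.greatest.1 h]
    exact hT.closed.closure_subset_iff.2 inter_subset_left
      (csInf_mem_closure ⟨b, hT.greatest.1, h⟩ ⟨t, fun x hx => hx.2.le⟩)

theorem rho_le (hT : IsScale T a b) {t : ℝ} (ht : t ∈ T) : rho T t ≤ t := by
  rcases (hT.least.2 ht).eq_or_lt with rfl | h
  · exact hT.rho_least.le
  · rw [rho_eq_sSup hT.least.1 h]
    exact csSup_le ⟨a, hT.least.1, h⟩ fun x hx => hx.2.le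

theorem rho_mem (hT : IsScale T a b) {t : ℝ} (ht : t ∈ T) : rho T t ∈ T := by
  rcases (hT.least.2 ht).eq_or_lt with rfl | h
  · rwa [hT.rho_least]
  · rw [rho_eq_sSup hT.least.1 h]
    exact hT.closed.closure_subset_iff.2 inter_subset_left
      (csSup_mem_closure ⟨a, hT.least.1, h⟩ ⟨t, fun x hx => hx.2.le⟩)

theorem rho_mono (hT : IsScale T a b) {s t : ℝ} (hs : s ∈ T) (ht : t ∈ T) (hst : s ≤ t) :
    rho T s ≤ rho T t := by
  rcases hst.eq_or_lt with rfl | h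
  · exact le_rfl
  · exact (hT.rho_le hs).trans (le_rho hs h)

theorem exists_gt_of_sigma_eq (hT : IsScale T a b) {t : ℝ} (htb : t < b)
    (h : sigma T t = t) {ε : ℝ} (hε : 0 < ε) : ∃ s ∈ T, t < s ∧ s < t + ε := by
  rw [sigma_eq_sInf hT.greatest.1 htb] at h
  obtain ⟨s, hs, hlt⟩ := exists_lt_of_csInf_lt (s := T ∩ Ioi t) (b := t + ε)
    ⟨b, hT.greatest.1, htb⟩ (by linarith)
  exact ⟨s, hs.1, hs.2, hlt⟩

theorem interval (hT : IsScale T a b) {s r : ℝ} (hs : s ∈ T) (hr : r ∈ T) (hsr : s ≤ r) :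
    IsScale (interval T s r) s r :=
  ⟨hT.closed.inter isClosed_Icc, ⟨⟨hs, le_rfl, hsr⟩, fun _ hx => hx.2.1⟩,
    ⟨⟨hr, hsr, le_rfl⟩, fun _ hx => hx.2.2⟩⟩

theorem interval_self (hT : IsScale T a b) : TimeScale.interval T a b = T :=
  inter_eq_left.2 fun _ hx => ⟨hT.least.2 hx, hT.greatest.2 hx⟩

theorem kappa_eq (hT : IsScale T a b) : kappa T = TimeScale.interval T a (rho T b) := by
  ext t
  constructor
  · rintro ⟨ht, h⟩
    refine ⟨ht, hT.least.2 ht, ?_⟩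
    rcases (hT.greatest.2 ht).eq_or_lt with rfl | hlt
    · rcases h with h | h
      · exact absurd hT.greatest h
      · exact h.ge
    · exact le_rho ht hlt
  · rintro ⟨ht, -, h⟩
    refine ⟨ht, ?_⟩
    rcases (hT.greatest.2 ht).eq_or_lt with rfl | hlt
    · exact Or.inr (le_antisymm (hT.rho_le ht) h)
    · exact Or.inl fun hg => (hg.2 hT.greatest.1).not_gt hlt

theorem mem_kappa_of_lt (hT : IsScale T a b) {t : ℝ} (ht : t ∈ T) (h : t < b) : t ∈ kappa T :=
  ⟨ht, Or.inl fun hg => (hg.2 hT.greatest.1).not_gt h⟩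

theorem mem_kappa_of_le (hT : IsScale T a b) {s t : ℝ} (ht : t ∈ kappa T) (hs : s ∈ T)
    (h : s ≤ t) : s ∈ kappa T := by
  rw [hT.kappa_eq] at ht ⊢
  exact ⟨hs, hT.least.2 hs, h.trans ht.2.2⟩

theorem rho_mem_kappa (hT : IsScale T a b) {t : ℝ} (ht : t ∈ T) : rho T t ∈ kappa T := by
  rw [hT.kappa_eq]
  exact ⟨hT.rho_mem ht, hT.least.2 (hT.rho_mem ht),
    hT.rho_mono ht hT.greatest.1 (hT.greatest.2 ht)⟩

theorem least_mem_kappa (hT : IsScale T a b) : a ∈ kappa T := by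
  have := hT.rho_mem_kappa hT.least.1
  rwa [hT.rho_least] at this

theorem proj_mem (hT : IsScale T a b) {x : ℝ} (hx : a ≤ x) : proj T x ∈ T :=
  hT.closed.closure_subset_iff.2 inter_subset_left
    (csSup_mem_closure ⟨a, hT.least.1, hx⟩ ⟨x, fun _ h => h.2⟩)

theorem proj_le (hT : IsScale T a b) {x : ℝ} (hx : a ≤ x) : proj T x ≤ x :=
  csSup_le ⟨a, hT.least.1, hx⟩ fun _ h => h.2

theorem proj_eq (hT : IsScale T a b) {s x : ℝ} (hs : s ∈ T) (hsx : s ≤ x) (hx : x < sigma T s) :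
    proj T x = s := by
  have hax := (hT.least.2 hs).trans hsx
  refine le_antisymm (not_lt.1 fun h => ?_) (le_proj hs hsx)
  exact ((sigma_le (hT.proj_mem hax) h).trans (hT.proj_le hax)).not_gt hx

theorem proj_interval (hT : IsScale T a b) {r x : ℝ} (hx : x ≤ r) :
    proj (TimeScale.interval T a r) x = proj T x := by
  unfold proj
  congr 1
  ext s
  exact ⟨fun h => ⟨h.1.1, h.2⟩, fun h => ⟨⟨h.1, hT.least.2 h.1, h.2.trans hx⟩, h.2⟩⟩

/-- A closed condition that holds at the minimum and propagates to the right reaches the maximum. -/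
theorem induction (hT : IsScale T a b) {C : Set ℝ} (hCT : C ⊆ T) (hC : IsClosed C) (haC : a ∈ C)
    (step : ∀ c ∈ C, c < b → ∃ s ∈ C, c < s) : b ∈ C := by
  have hbdd : BddAbove C := ⟨b, fun x hx => hT.greatest.2 (hCT hx)⟩
  have hm := hC.csSup_mem ⟨a, haC⟩ hbdd
  rcases (hT.greatest.2 (hCT hm)).eq_or_lt with h | h
  · rwa [h] at hm
  · obtain ⟨s, hs, hlt⟩ := step _ hm h
    exact absurd (le_csSup hbdd hs) hlt.not_ge

theorem nhdsWithin_greatest (hT : IsScale T a b) (h : rho T b ≠ b) : 𝓝[T] b = pure b := by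
  have hb := hT.greatest.1
  have hlt : rho T b < b := (hT.rho_le hb).lt_of_ne h
  refine le_antisymm ?_ (pure_le_nhdsWithin hb)
  rw [le_pure_iff]
  filter_upwards [self_mem_nhdsWithin, nhdsWithin_le_nhds (Ioi_mem_nhds hlt)] with x hx hx'
  by_contra hne
  exact (le_rho hx ((hT.greatest.2 hx).lt_of_ne hne)).not_gt hx'

/-- Continuity on `T^κ` is continuity on `T`: a maximum outside `T^κ` is isolated. -/
theorem continuousOn_of_kappa (hT : IsScale T a b) {g : ℝ → ℝ}
    (hg : ∀ t ∈ kappa T, ContinuousWithinAt g T t) : ContinuousOn g T := by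
  intro t ht
  by_cases hk : t ∈ kappa T
  · exact hg t hk
  · have htb : t = b := by
      by_contra hne
      exact hk (hT.mem_kappa_of_lt ht ((hT.greatest.2 ht).lt_of_ne hne))
    subst htb
    rw [ContinuousWithinAt, hT.nhdsWithin_greatest fun h => hk ⟨ht, Or.inr h⟩]
    exact tendsto_pure_nhds g t

end IsScale

/-! ### The `Δ`-derivative and monotonicity -/

theorem hasDeltaDerivAt_iff_of_dense {F : ℝ → ℝ} {d t : ℝ} (h : sigma T t = t) :
    HasDeltaDerivAt T F d t ↔ HasDerivWithinAt F d T t := by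
  rw [HasDeltaDerivAt, hasDerivWithinAt_iff_isLittleO, Asymptotics.isLittleO_iff, h]
  refine forall₂_congr fun ε hε => ?_
  rw [Metric.nhdsWithin_basis_ball.eventually_iff]
  refine exists_congr fun δ => and_congr_right fun _ => ?_
  have key : ∀ s : ℝ, |F t - F s - d * (t - s)| = ‖F s - F t - (s - t) • d‖ := fun s => by
    rw [Real.norm_eq_abs, ← abs_neg, smul_eq_mul]; ring_nf
  simp only [key, mem_inter_iff, Metric.mem_ball, Real.dist_eq, Real.norm_eq_abs, abs_sub_comm t]
  exact ⟨fun H s hs => H s hs.2 hs.1, fun H s hs hs' => H ⟨hs', hs⟩⟩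

/-- Near a right-scattered `t` the factor `|σ(t) - s|` is bounded and bounded away from `0`. The
defining estimate thus says only that `F(s) + d (σ(t) - s)` tends to `F(σ(t))`, and `s = t` turns
this into an exact difference quotient. -/
theorem hasDeltaDerivAt_iff_of_scattered {F : ℝ → ℝ} {d t : ℝ} (ht : t ∈ T) (h : t < sigma T t) :
    HasDeltaDerivAt T F d t ↔
      ContinuousWithinAt F T t ∧ F (sigma T t) = F t + d * (sigma T t - t) := by
  set m := sigma T t with hm
  have hlin : ContinuousWithinAt (fun s => F m - d * (m - s)) T t := by fun_prop
  constructor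
  · intro H
    have heq : F m = F t + d * (m - t) := by
      have : |F m - F t - d * (m - t)| ≤ 0 := by
        refine le_of_forall_pos_le_add fun ε hε => ?_
        obtain ⟨δ, hδ, H⟩ := H (ε / (m - t)) (div_pos hε (sub_pos.2 h))
        have := H t ht (by simpa using hδ)
        rwa [abs_of_pos (sub_pos.2 h), div_mul_cancel₀ _ (sub_pos.2 h).ne', ← zero_add ε] at this
      linarith [abs_nonpos_iff.1 this]
    refine ⟨?_, heq⟩
    have hz : Tendsto (fun s => F m - F s - d * (m - s)) (𝓝[T] t) (𝓝 0) := by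
      rw [Metric.tendsto_nhds]
      intro ε hε
      obtain ⟨δ, hδ, H⟩ := H (ε / (2 * (m - t + 1))) (by have := sub_pos.2 h; positivity)
      have : Metric.ball t (min δ 1) ∈ 𝓝[T] t :=
        nhdsWithin_le_nhds (Metric.ball_mem_nhds _ (by positivity))
      filter_upwards [self_mem_nhdsWithin, this] with s hs hs'
      rw [Metric.mem_ball, Real.dist_eq, lt_min_iff] at hs'
      have h1 := H s hs hs'.1
      have h2 : |m - s| ≤ m - t + 1 := by
        have := abs_lt.1 hs'.2
        rw [abs_le]; constructor <;> linarith
      rw [Real.dist_eq, sub_zero]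
      have hp : 0 < m - t + 1 := by linarith
      calc _ ≤ _ := h1
        _ ≤ ε / (2 * (m - t + 1)) * (m - t + 1) := by gcongr
        _ = ε / 2 := by field_simp
        _ < ε := by linarith
    have := hlin.tendsto.sub hz
    refine (this.congr fun s => by ring).trans_eq ?_
    congr 1; rw [heq]; ring
  · rintro ⟨hc, heq⟩ ε hε
    have hz : Tendsto (fun s => F m - d * (m - s) - F s) (𝓝[T] t) (𝓝 0) := by
      refine (hlin.tendsto.sub hc).trans_eq ?_
      congr 1; rw [heq]; ring
    have hp := sub_pos.2 h
    have := (Metric.tendsto_nhds.1 hz (ε * ((m - t) / 2)) (by positivity))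
    obtain ⟨δ, hδ, H⟩ := Metric.nhdsWithin_basis_ball.eventually_iff.1 this
    refine ⟨min δ ((m - t) / 2), by positivity, fun s hs hst => ?_⟩
    rw [lt_min_iff] at hst
    have h1 := H ⟨by simpa [Real.dist_eq] using hst.1, hs⟩
    rw [Real.dist_eq, sub_zero] at h1
    have h2 : (m - t) / 2 ≤ |m - s| := by
      refine le_trans ?_ (le_abs_self _)
      have := abs_lt.1 hst.2
      linarith
    calc |F m - F s - d * (m - s)| = |F m - d * (m - s) - F s| := by ring_nf
      _ ≤ ε * ((m - t) / 2) := h1.le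
      _ ≤ ε * |m - s| := by gcongr

namespace IsScale

theorem hasDeltaDerivAt_iff (hT : IsScale T a b) {F : ℝ → ℝ} {d t : ℝ} (ht : t ∈ T) :
    HasDeltaDerivAt T F d t ↔
      (sigma T t = t → HasDerivWithinAt F d T t) ∧
      (t < sigma T t → ContinuousWithinAt F T t ∧ F (sigma T t) = F t + d * (sigma T t - t)) := by
  rcases (hT.le_sigma ht).eq_or_lt with h | h
  · simp [hasDeltaDerivAt_iff_of_dense h.symm, ← h]
  · simp [hasDeltaDerivAt_iff_of_scattered ht h, h, h.ne']

theorem continuousWithinAt (hT : IsScale T a b) {F : ℝ → ℝ} {d t : ℝ} (ht : t ∈ T)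
    (h : HasDeltaDerivAt T F d t) : ContinuousWithinAt F T t := by
  rw [hT.hasDeltaDerivAt_iff ht] at h
  rcases (hT.le_sigma ht).eq_or_lt with h' | h'
  · exact (h.1 h'.symm).continuousWithinAt
  · exact (h.2 h').1

/-- A function with nonpositive `Δ`-derivative does not increase. -/
theorem le_of_deriv_nonpos (hT : IsScale T a b) {F : ℝ → ℝ} (hF : ContinuousOn F T)
    (hs : ∀ t ∈ T, t < b → t < sigma T t → F (sigma T t) ≤ F t)
    (hd : ∀ t ∈ T, t < b → sigma T t = t → ∃ d ≤ 0, HasDerivWithinAt F d T t) : F b ≤ F a := by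
  -- The slack `ε` absorbs the error term of the derivative at a right-dense point, so the bound
  -- passes from `c` to a point on its right.
  suffices H : ∀ ε > 0, F b ≤ F a + ε * (b - a) by
    have h : Tendsto (fun ε : ℝ => F a + ε * (b - a)) (𝓝[>] 0) (𝓝 (F a + 0 * (b - a))) :=
      Continuous.tendsto (by fun_prop) 0 |>.mono_left nhdsWithin_le_nhds
    have := ge_of_tendsto h (b := F b) (by filter_upwards [self_mem_nhdsWithin] with ε hε using H ε hε)
    simpa using this
  intro ε hε
  have hC : IsClosed {t ∈ T | F t ≤ F a + ε * (t - a)} :=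
    hT.closed.isClosed_le hF (by fun_prop)
  refine (hT.induction (C := {t ∈ T | F t ≤ F a + ε * (t - a)}) (fun x hx => hx.1) hC
    ⟨hT.least.1, by simp⟩ ?_).2
  rintro c ⟨hc, hFc⟩ hcb
  rcases (hT.le_sigma hc).eq_or_lt with h | h
  · obtain ⟨d, hd0, hd⟩ := hd c hc hcb h.symm
    obtain ⟨δ, hδ, H⟩ := (hasDeltaDerivAt_iff_of_dense h.symm).2 hd ε hε
    obtain ⟨s, hs, hcs, hsδ⟩ := hT.exists_gt_of_sigma_eq hcb h.symm hδ
    refine ⟨s, ⟨hs, ?_⟩, hcs⟩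
    have := H s hs (by rw [abs_of_pos] <;> linarith)
    rw [← h, abs_of_neg (a := c - s) (by linarith)] at this
    have h1 := (abs_le.1 this).1
    nlinarith [mul_nonneg (neg_nonneg.2 hd0) (sub_nonneg.2 hcs.le)]
  · refine ⟨_, ⟨hT.sigma_mem hc, (hs c hc hcb h).trans (hFc.trans ?_)⟩, h⟩
    gcongr

theorem le_of_hasDeltaDerivAt (hT : IsScale T a b) {F d : ℝ → ℝ} (hF : ContinuousOn F T)
    (hd : ∀ t ∈ T, t < b → HasDeltaDerivAt T F (d t) t) (hd0 : ∀ t ∈ T, t < b → d t ≤ 0) :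
    F b ≤ F a := by
  refine hT.le_of_deriv_nonpos hF (fun t ht htb h => ?_) (fun t ht htb h => ?_)
  · have := (((hT.hasDeltaDerivAt_iff ht).1 (hd t ht htb)).2 h).2
    nlinarith [hd0 t ht htb]
  · exact ⟨d t, hd0 t ht htb, ((hT.hasDeltaDerivAt_iff ht).1 (hd t ht htb)).1 h⟩

end IsScale

/-- Truncation at `r` leaves `σ(t)` unchanged exactly because `t < r`. -/
theorem hasDeltaDerivAt_interval {F : ℝ → ℝ} {d s r t : ℝ} (hr : r ∈ T)
    (hst : s ≤ t) (htr : t < r) (h : HasDeltaDerivAt T F d t) :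
    HasDeltaDerivAt (interval T s r) F d t := by
  intro ε hε
  obtain ⟨δ, hδ, H⟩ := h ε hε
  refine ⟨δ, hδ, fun x hx hxt => ?_⟩
  rw [sigma_interval hr hst htr]
  exact H x hx.1 hxt

theorem HasDeltaDerivAt.sub {F G : ℝ → ℝ} {d e t : ℝ} (hF : HasDeltaDerivAt T F d t)
    (hG : HasDeltaDerivAt T G e t) : HasDeltaDerivAt T (fun x => F x - G x) (d - e) t := by
  intro ε hε
  obtain ⟨δ, hδ, H⟩ := hF (ε / 2) (by positivity)
  obtain ⟨δ', hδ', H'⟩ := hG (ε / 2) (by positivity)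
  refine ⟨min δ δ', by positivity, fun s hs hst => ?_⟩
  rw [lt_min_iff] at hst
  have h1 := abs_le.1 (H s hs hst.1)
  have h2 := abs_le.1 (H' s hs hst.2)
  rw [abs_le]
  constructor <;> linarith

namespace IsScale

/-- The difference of two antiderivatives has derivative zero before `r`, so it neither increases
nor decreases. Hence the arbitrary choice in `integral` is harmless. -/
theorem integral_eq_of_antideriv (hT : IsScale T a b) {F g : ℝ → ℝ} {r : ℝ} (hr : r ∈ T)
    (hF : IsAntiderivBetween T F g a r) : integral T g a r = F r - F a := by
  have har := hT.least.2 hr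
  have hS := hT.interval hT.least.1 hr har
  have h : ∃ F : ℝ → ℝ, IsAntiderivBetween T F g a r := ⟨F, hF⟩
  rw [integral, dif_pos h]
  have hG := h.choose_spec
  set G := h.choose
  unfold IsAntiderivBetween at hF hG
  rw [min_eq_left har, max_eq_right har] at hF hG
  have h1 := hS.le_of_hasDeltaDerivAt (d := fun t => g t - g t) (hF.1.sub hG.1)
    (fun t ht htr => (hF.2 t ht htr).sub (hG.2 t ht htr)) (by simp)
  have h2 := hS.le_of_hasDeltaDerivAt (d := fun t => g t - g t) (hG.1.sub hF.1)
    (fun t ht htr => (hG.2 t ht htr).sub (hF.2 t ht htr)) (by simp)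
  simp only [Pi.sub_apply] at h1 h2
  linarith

end IsScale

/-! ### Rd-continuous functions -/

namespace RdContinuousOn

variable {S S' : Set ℝ} {g h : ℝ → ℝ}

theorem mono (hg : RdContinuousOn T S g) (h : S' ⊆ S) : RdContinuousOn T S' g :=
  ⟨fun t ht hs => (hg.1 t (h ht) hs).mono h, fun t ht hr => (hg.2 t (h ht) hr).imp fun _ hl =>
    hl.mono_left (nhdsWithin_mono _ (inter_subset_inter_left _ h))⟩

theorem of_continuousOn (hg : ContinuousOn g S) : RdContinuousOn T S g :=
  ⟨fun t ht _ => hg t ht, fun t ht _ =>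
    ⟨g t, (hg t ht).mono_left (nhdsWithin_mono _ inter_subset_left)⟩⟩

theorem mul (hg : RdContinuousOn T S g) (hh : RdContinuousOn T S h) :
    RdContinuousOn T S fun t => g t * h t :=
  ⟨fun t ht hs => (hg.1 t ht hs).mul (hh.1 t ht hs), fun t ht hr => by
    obtain ⟨l, hl⟩ := hg.2 t ht hr
    obtain ⟨m, hm⟩ := hh.2 t ht hr
    exact ⟨_, hl.mul hm⟩⟩

theorem add (hg : RdContinuousOn T S g) (hh : RdContinuousOn T S h) :
    RdContinuousOn T S fun t => g t + h t :=
  ⟨fun t ht hs => (hg.1 t ht hs).add (hh.1 t ht hs), fun t ht hr => by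
    obtain ⟨l, hl⟩ := hg.2 t ht hr
    obtain ⟨m, hm⟩ := hh.2 t ht hr
    exact ⟨_, hl.add hm⟩⟩

theorem const_mul (c : ℝ) (hg : RdContinuousOn T S g) : RdContinuousOn T S fun t => c * g t :=
  (of_continuousOn continuousOn_const).mul hg

theorem comp {φ : ℝ → ℝ} (hφ : ContinuousOn φ (Ici 0)) (hg : RdContinuousOn T S g)
    (hg0 : ∀ t ∈ S, 0 ≤ g t) : RdContinuousOn T S fun t => φ (g t) := by
  refine ⟨fun t ht hs => (hφ _ (hg0 t ht)).comp (hg.1 t ht hs) fun x hx => hg0 x hx,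
    fun t ht hr => ?_⟩
  obtain ⟨l, hl⟩ := hg.2 t ht hr
  -- The filter is trivial when no points of `S` accumulate from the left, for instance at the
  -- minimum of `T`, which counts as left-dense; any limit then serves.
  by_cases hne : (𝓝[S ∩ Iio t] t).NeBot
  · have hev : ∀ᶠ x in 𝓝[S ∩ Iio t] t, g x ∈ Ici (0 : ℝ) := by
      filter_upwards [self_mem_nhdsWithin] with x hx using hg0 x hx.1
    have hl0 : 0 ≤ l := ge_of_tendsto hl hev
    exact ⟨φ l, (hφ l hl0).tendsto.comp (tendsto_nhdsWithin_iff.2 ⟨hl, hev⟩)⟩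
  · rw [not_neBot.1 hne]
    exact ⟨0, tendsto_bot⟩

end RdContinuousOn

/-! ### The `Δ`-integral as a Lebesgue integral -/

open Classical in
/-- The `Δ`-integral only depends on the values of the integrand before the right end point. -/
theorem integral_congr {g h : ℝ → ℝ} {r : ℝ} (har : a ≤ r) (hgh : ∀ t ∈ T, a ≤ t → t < r → g t = h t) :
    integral T g a r = integral T h a r := by
  -- The integral sees the integrand only through this predicate, so equal predicates give the same
  -- chosen antiderivative, with no regularity assumed.
  have : (fun F => IsAntiderivBetween T F g a r) = fun F => IsAntiderivBetween T F h a r := by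
    funext F
    simp only [IsAntiderivBetween, min_eq_left har, max_eq_right har]
    refine propext (and_congr_right fun _ => forall₃_congr fun t ht htr => ?_)
    rw [hgh t ht.1 ht.2.1 htr]
  unfold integral
  change (if h : ∃ F, (fun F => IsAntiderivBetween T F g a r) F then h.choose r - h.choose a
    else 0) = _
  rw [this]

theorem integral_congr_of_Ioo {f g : ℝ → ℝ} (hab : a ≤ b) (h : EqOn f g (Ioo a b)) :
    ∫ x in a..b, f x = ∫ x in a..b, g x := by
  rw [intervalIntegral.integral_of_le hab, intervalIntegral.integral_of_le hab,
    MeasureTheory.integral_Ioc_eq_integral_Ioo, MeasureTheory.integral_Ioc_eq_integral_Ioo]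
  exact MeasureTheory.setIntegral_congr_fun measurableSet_Ioo h

namespace IsScale

/-- On `[s, σ(s))` the integrand is constantly `g s`, which gives the exact increment at a scattered
point. At a dense point, `proj T x` stays between `r` and `s` along with `x`, so continuity of `g`
at `s` controls the mean value. -/
theorem hasDeltaDerivAt_primitive (hT : IsScale T a b) {g : ℝ → ℝ}
    (hg : IntervalIntegrable (fun x => g (proj T x)) MeasureTheory.volume a b) {s : ℝ} (hs : s ∈ T)
    (hc : sigma T s = s → ContinuousWithinAt g T s) :
    HasDeltaDerivAt T (fun t => ∫ x in a..t, g (proj T x)) (g s) s := by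
  have hint : ∀ c ∈ T, ∀ d ∈ T,
      IntervalIntegrable (fun x => g (proj T x)) MeasureTheory.volume c d := fun c hc d hd =>
    hg.mono_set (uIcc_subset_uIcc (by rw [uIcc_of_le hT.le]; exact ⟨hT.least.2 hc, hT.greatest.2 hc⟩)
      (by rw [uIcc_of_le hT.le]; exact ⟨hT.least.2 hd, hT.greatest.2 hd⟩))
  have hdiff : ∀ c ∈ T, ∀ d ∈ T, (∫ x in a..d, g (proj T x)) - ∫ x in a..c, g (proj T x) =
      ∫ x in c..d, g (proj T x) := fun c hc d hd =>
    intervalIntegral.integral_interval_sub_left (hint a hT.least.1 d hd) (hint a hT.least.1 c hc)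
  rcases (hT.le_sigma hs).eq_or_lt with h | h
  · intro ε hε
    obtain ⟨δ, hδ, H⟩ := Metric.continuousWithinAt_iff.1 (hc h.symm) ε hε
    refine ⟨δ, hδ, fun r hr hrs => ?_⟩
    have e : (∫ x in a..s, g (proj T x)) - (∫ x in a..r, g (proj T x)) - g s * (s - r) =
        ∫ x in r..s, (g (proj T x) - g s) := by
      rw [intervalIntegral.integral_sub (hint r hr s hs) intervalIntegrable_const,
        intervalIntegral.integral_const, smul_eq_mul, hdiff r hr s hs, mul_comm]
    rw [← h, e, ← Real.norm_eq_abs]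
    refine intervalIntegral.norm_integral_le_of_norm_le_const fun x hx => ?_
    have hx' : min r s < x ∧ x ≤ max r s := hx
    have hmin : min r s ∈ T := by rcases min_choice r s with h | h <;> rwa [h]
    have hax : a ≤ x := (hT.least.2 hmin).trans hx'.1.le
    have h1 : min r s ≤ proj T x := le_proj hmin hx'.1.le
    have h2 : proj T x ≤ max r s := (hT.proj_le hax).trans hx'.2
    refine (H (hT.proj_mem hax) ?_).le
    rw [Real.dist_eq]
    refine lt_of_le_of_lt ?_ hrs
    rcases le_total r s with h | h
    · rw [min_eq_left h] at h1
      rw [max_eq_right h] at h2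
      rw [abs_of_nonpos (by linarith), abs_of_nonpos (by linarith)]; linarith
    · rw [min_eq_right h] at h1
      rw [max_eq_left h] at h2
      rw [abs_of_nonneg (by linarith), abs_of_nonneg (by linarith)]; linarith
  · rw [hasDeltaDerivAt_iff_of_scattered hs h]
    constructor
    · have := intervalIntegral.continuousOn_primitive_interval' hg left_mem_uIcc
      rw [uIcc_of_le hT.le] at this
      exact (this s ⟨hT.least.2 hs, hT.greatest.2 hs⟩).mono
        fun x hx => ⟨hT.least.2 hx, hT.greatest.2 hx⟩
    · have : ∫ x in s..sigma T s, g (proj T x) = ∫ _ in s..sigma T s, g s :=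
        integral_congr_of_Ioo h.le fun x hx => by simp only [hT.proj_eq hs hx.1.le hx.2]
      rw [intervalIntegral.integral_const, smul_eq_mul, ← hdiff s hs _ (hT.sigma_mem hs)] at this
      linarith

/-- If `proj T x` is right-dense it equals `x`, and `proj T y` is squeezed between `x` and `y`. If
it is right-scattered, `proj T` is constant just to the right of `x`. -/
theorem tendsto_comp_proj (hT : IsScale T a b) {g : ℝ → ℝ} {r x : ℝ} (hr : r ∈ T)
    (hg : RdContinuousOn T (TimeScale.interval T a r) g) (hax : a ≤ x) (hxr : x < r) :
    Tendsto (fun y => g (proj T y)) (𝓝[>] x) (𝓝 (g (proj T x))) := by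
  have hs := hT.proj_mem hax
  have hsx := hT.proj_le hax
  rcases (hT.le_sigma hs).eq_or_lt with h | h
  · have hx : proj T x = x := by
      by_contra hne
      have hlt := hsx.lt_of_ne hne
      obtain ⟨s, hs', h1, h2⟩ := hT.exists_gt_of_sigma_eq
        ((hsx.trans_lt hxr).trans_le (hT.greatest.2 hr)) h.symm (sub_pos.2 hlt)
      exact (le_proj hs' (by linarith : s ≤ x)).not_gt h1
    rw [hx] at hs h ⊢
    have hc := hg.1 x ⟨hs, hax, hxr.le⟩ h.symm
    refine hc.tendsto.comp (tendsto_nhdsWithin_iff.2 ⟨?_, ?_⟩)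
    · refine tendsto_of_tendsto_of_tendsto_of_le_of_le' tendsto_const_nhds
        (tendsto_id.mono_left nhdsWithin_le_nhds) ?_ ?_
      · filter_upwards [self_mem_nhdsWithin] with y hy using le_proj hs (le_of_lt hy)
      · filter_upwards [self_mem_nhdsWithin] with y hy using hT.proj_le (hax.trans (le_of_lt hy))
    · filter_upwards [self_mem_nhdsWithin, nhdsWithin_le_nhds (Iio_mem_nhds hxr)] with y hy hy'
      have hay := hax.trans (le_of_lt hy)
      exact ⟨hT.proj_mem hay, hT.least.2 (hT.proj_mem hay), (hT.proj_le hay).trans (le_of_lt hy')⟩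
  · have hlt : x < sigma T (proj T x) := by
      by_contra hle
      exact (le_proj (hT.sigma_mem hs) (not_lt.1 hle)).not_gt h
    refine tendsto_const_nhds.congr' ?_
    filter_upwards [self_mem_nhdsWithin, nhdsWithin_le_nhds (Iio_mem_nhds hlt)] with y hy hy'
    rw [hT.proj_eq hs (hsx.trans (le_of_lt hy)) hy']

/-- By right-continuity the function is the limit of its values at the grid points `(⌊(n+1)x⌋ +
1)/(n+1)`, which lie strictly to the right of `x`. Each approximant factors through `ℤ` and is
therefore measurable. -/
theorem aestronglyMeasurable_comp_proj (hT : IsScale T a b) {g : ℝ → ℝ} {r : ℝ} (hr : r ∈ T)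
    (hg : RdContinuousOn T (TimeScale.interval T a r) g) :
    MeasureTheory.AEStronglyMeasurable (fun x => g (proj T x))
      (MeasureTheory.volume.restrict (Ioo a r)) := by
  refine aestronglyMeasurable_of_tendsto_ae atTop
    (f := fun (n : ℕ) x => g (proj T ((⌊(n + 1 : ℝ) * x⌋ + 1) / (n + 1 : ℝ)))) (fun n => ?_) ?_
  · have h1 : Measurable fun m : ℤ => g (proj T ((m + 1) / (n + 1 : ℝ))) := measurable_from_top
    have h2 : Measurable fun x : ℝ => ⌊(n + 1 : ℝ) * x⌋ := (measurable_const_mul _).floor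
    exact (h1.comp h2).aestronglyMeasurable
  · refine (MeasureTheory.ae_restrict_iff' measurableSet_Ioo).2 (.of_forall fun x hx => ?_)
    refine (hT.tendsto_comp_proj hr hg hx.1.le hx.2).comp (tendsto_nhdsWithin_iff.2 ⟨?_, ?_⟩)
    · have h0 : Tendsto (fun n : ℕ => x + 1 / ((n : ℝ) + 1)) atTop (𝓝 (x + 0)) :=
        tendsto_const_nhds.add tendsto_one_div_add_atTop_nhds_zero_nat
      rw [add_zero] at h0
      refine tendsto_of_tendsto_of_tendsto_of_le_of_le tendsto_const_nhds h0 (fun n => ?_)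
        (fun n => ?_)
      · have hn : (0 : ℝ) < n + 1 := by positivity
        have := Int.lt_floor_add_one ((n + 1 : ℝ) * x)
        rw [le_div_iff₀ hn]; linarith
      · have hn : (0 : ℝ) < n + 1 := by positivity
        have := Int.floor_le ((n + 1 : ℝ) * x)
        simp only
        rw [add_div]
        gcongr
        rw [div_le_iff₀ hn]; linarith
    · refine Eventually.of_forall fun n => ?_
      have hn : (0 : ℝ) < n + 1 := by positivity
      have := Int.lt_floor_add_one ((n + 1 : ℝ) * x)
      rw [mem_Ioi, lt_div_iff₀ hn]; linarith

/-- By compactness a local bound suffices. It comes from continuity at right-dense points; at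
right-scattered ones, only `t` and the points on its left matter, and these are handled by the left
limit or are absent near `t`. -/
theorem exists_bound (hT : IsScale T a b) {g : ℝ → ℝ} {r : ℝ} (hr : r ∈ T)
    (hg : RdContinuousOn T (TimeScale.interval T a r) g) :
    ∃ M, ∀ t ∈ TimeScale.interval T a r, |g t| ≤ M := by
  have hS := hT.interval hT.least.1 hr (hT.least.2 hr)
  have of_tendsto : ∀ {l : Filter ℝ} {c : ℝ}, Tendsto g l (𝓝 c) →
      ∀ᶠ x in l, |g x| ≤ |c| + 1 := fun {l c} h =>
    (h.abs.eventually (Iio_mem_nhds (lt_add_one |c|))).mono fun x hx => le_of_lt hx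
  refine hS.isCompact.induction_on (p := fun s => ∃ M, ∀ t ∈ s, |g t| ≤ M) ⟨0, by simp⟩
    (fun s t hst ⟨M, hM⟩ => ⟨M, fun x hx => hM x (hst hx)⟩)
    (fun s t ⟨M, hM⟩ ⟨N, hN⟩ => ⟨max M N, ?_⟩) (fun t ht => ?_)
  · rintro x (hx | hx)
    · exact (hM x hx).trans (le_max_left _ _)
    · exact (hN x hx).trans (le_max_right _ _)
  · rcases (hT.le_sigma ht.1).eq_or_lt with h | h
    · exact ⟨_, of_tendsto (hg.1 t ht h.symm), _, fun x hx => hx⟩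
    · obtain ⟨M, hM⟩ : ∃ M, ∀ᶠ x in 𝓝[TimeScale.interval T a r ∩ Iio t] t, |g x| ≤ M := by
        rcases (hT.rho_le ht.1).eq_or_lt with h' | h'
        · obtain ⟨l, hl⟩ := hg.2 t ht h'
          exact ⟨_, of_tendsto hl⟩
        · refine ⟨0, ?_⟩
          filter_upwards [self_mem_nhdsWithin, nhdsWithin_le_nhds (Ioi_mem_nhds h')] with x hx hx'
          exact absurd (le_rho hx.1.1 hx.2) (not_le.2 hx')
      refine ⟨{x | |g x| ≤ max M |g t|}, ?_, _, fun x hx => hx⟩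
      rw [eventually_nhdsWithin_iff] at hM
      change ∀ᶠ x in _, _
      rw [eventually_nhdsWithin_iff]
      filter_upwards [hM, Iio_mem_nhds h] with x hx hxσ hxS
      rcases lt_trichotomy x t with hlt | rfl | hgt
      · exact (hx ⟨hxS, hlt⟩).trans (le_max_left _ _)
      · exact le_max_right _ _
      · exact absurd (sigma_le hxS.1 hgt) (not_le.2 hxσ)

theorem intervalIntegrable_comp_proj (hT : IsScale T a b) {g : ℝ → ℝ} {r : ℝ} (hr : r ∈ T)
    (hg : RdContinuousOn T (TimeScale.interval T a r) g) :
    IntervalIntegrable (fun x => g (proj T x)) MeasureTheory.volume a r := by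
  rw [intervalIntegrable_iff_integrableOn_Ioo_of_le (hT.least.2 hr)]
  obtain ⟨M, hM⟩ := hT.exists_bound hr hg
  refine MeasureTheory.IntegrableOn.of_bound (by simp)
    (hT.aestronglyMeasurable_comp_proj hr hg) M ?_
  refine (MeasureTheory.ae_restrict_iff' measurableSet_Ioo).2 (.of_forall fun x hx => ?_)
  have := hT.proj_mem hx.1.le
  exact hM _ ⟨this, hT.least.2 this, (hT.proj_le hx.1.le).trans hx.2.le⟩

/-- The `Δ`-integral of an rd-continuous function is a Lebesgue integral. -/
theorem integral_eq (hT : IsScale T a b) {g : ℝ → ℝ} {r : ℝ} (hr : r ∈ T)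
    (hg : RdContinuousOn T (TimeScale.interval T a r) g) :
    integral T g a r = ∫ x in a..r, g (proj T x) := by
  have har := hT.least.2 hr
  have hS := hT.interval hT.least.1 hr har
  have hi := hT.intervalIntegrable_comp_proj hr hg
  have hcongr : ∀ t ≤ r, ∀ x ∈ uIoc a t, a ≤ t →
      g (proj (TimeScale.interval T a r) x) = g (proj T x) := fun t ht x hx hat => by
    rw [uIoc_of_le hat] at hx
    rw [hT.proj_interval (hx.2.trans ht)]
  have hi' : IntervalIntegrable (fun x => g (proj (TimeScale.interval T a r) x))
      MeasureTheory.volume a r :=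
    hi.congr fun x hx => (hcongr r le_rfl x hx har).symm
  have hF : IsAntiderivBetween T
      (fun t => ∫ x in a..t, g (proj (TimeScale.interval T a r) x)) g a r := by
    rw [IsAntiderivBetween, min_eq_left har, max_eq_right har]
    constructor
    · have := intervalIntegral.continuousOn_primitive_interval' hi' left_mem_uIcc
      rw [uIcc_of_le har] at this
      exact this.mono fun x hx => hx.2
    · intro t ht htr
      refine hS.hasDeltaDerivAt_primitive hi' ht fun h => hg.1 t ht ?_
      rwa [sigma_interval hr ht.2.1 htr] at h
  rw [hT.integral_eq_of_antideriv hr hF, intervalIntegral.integral_same, sub_zero]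
  exact integral_congr_of_Ioo har fun x hx =>
    hcongr r le_rfl x (by rw [uIoc_of_le har]; exact Ioo_subset_Ioc_self hx) har

theorem integral_self (hT : IsScale T a b) (g : ℝ → ℝ) : integral T g a a = 0 := by
  rw [hT.integral_eq_of_antideriv (F := fun _ => 0) hT.least.1, sub_zero]
  rw [IsAntiderivBetween, min_self, max_self]
  exact ⟨continuousOn_const, fun t ht h => absurd ht.2.1 (not_le.2 h)⟩

theorem integral_mono (hT : IsScale T a b) {g h : ℝ → ℝ} {r : ℝ} (hr : r ∈ T)
    (hg : RdContinuousOn T (TimeScale.interval T a r) g)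
    (hh : RdContinuousOn T (TimeScale.interval T a r) h)
    (hgh : ∀ t ∈ T, t < r → g t ≤ h t) : integral T g a r ≤ integral T h a r := by
  rw [hT.integral_eq hr hg, hT.integral_eq hr hh]
  refine intervalIntegral.integral_mono_on_of_le_Ioo (hT.least.2 hr)
    (hT.intervalIntegrable_comp_proj hr hg) (hT.intervalIntegrable_comp_proj hr hh) fun x hx => ?_
  exact hgh _ (hT.proj_mem hx.1.le) ((hT.proj_le hx.1.le).trans_lt hx.2)

theorem integral_const_mul (hT : IsScale T a b) (c : ℝ) {g : ℝ → ℝ} {r : ℝ} (hr : r ∈ T)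
    (hg : RdContinuousOn T (TimeScale.interval T a r) g) :
    integral T (fun t => c * g t) a r = c * integral T g a r := by
  rw [hT.integral_eq hr hg, hT.integral_eq hr (hg.const_mul c),
    intervalIntegral.integral_const_mul]

theorem integral_nonneg (hT : IsScale T a b) {g : ℝ → ℝ} {r : ℝ} (hr : r ∈ T)
    (hg : RdContinuousOn T (TimeScale.interval T a r) g) (h : ∀ t ∈ T, t < r → 0 ≤ g t) :
    0 ≤ integral T g a r := by
  rw [hT.integral_eq hr hg]
  have := intervalIntegral.integral_mono_on_of_le_Ioo (f := fun _ => (0 : ℝ)) (hT.least.2 hr)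
    intervalIntegrable_const (hT.intervalIntegrable_comp_proj hr hg) fun x hx =>
      h _ (hT.proj_mem hx.1.le) ((hT.proj_le hx.1.le).trans_lt hx.2)
  simpa using this

theorem integral_mono_right (hT : IsScale T a b) {g : ℝ → ℝ} (hg : RdContinuousOn T T g)
    (h : ∀ t ∈ kappa T, 0 ≤ g t) : MonotoneOn (fun t => integral T g a t) T := by
  intro s hs t ht hst
  have hi := fun {r} hr => hT.intervalIntegrable_comp_proj (r := r) hr
    (hg.mono inter_subset_left)
  simp only [hT.integral_eq hs (hg.mono inter_subset_left),
    hT.integral_eq ht (hg.mono inter_subset_left)]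
  rw [← sub_nonneg, intervalIntegral.integral_interval_sub_left (hi ht) (hi hs)]
  have := intervalIntegral.integral_mono_on_of_le_Ioo (f := fun _ => (0 : ℝ)) hst
    intervalIntegrable_const ((hi hs).symm.trans (hi ht)) fun x hx => by
      have hax := (hT.least.2 hs).trans hx.1.le
      exact h _ (hT.mem_kappa_of_lt (hT.proj_mem hax)
        (((hT.proj_le hax).trans_lt hx.2).trans_le (hT.greatest.2 ht)))
  simpa using this

/-- The value at a left-scattered right end point is irrelevant for rd-continuity. -/
theorem rdContinuousOn_of_rho (hT : IsScale T a b) {g : ℝ → ℝ} {t : ℝ} (ht : t ∈ T)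
    (hg : RdContinuousOn T (TimeScale.interval T a (rho T t)) g) :
    RdContinuousOn T (TimeScale.interval T a t) g := by
  by_cases h : rho T t = t
  · rwa [h] at hg
  have hlt : rho T t < t := (hT.rho_le ht).lt_of_ne h
  have hsub : ∀ s ∈ TimeScale.interval T a t, s ≠ t → s ∈ TimeScale.interval T a (rho T t) :=
    fun s hs hne => ⟨hs.1, hs.2.1, le_rho hs.1 (hs.2.2.lt_of_ne hne)⟩
  constructor
  · intro s hs hσ
    rcases hs.2.2.eq_or_lt with rfl | hst
    · have := (hT.interval hT.least.1 ht (hT.least.2 ht)).greatest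
      have hpure : 𝓝[TimeScale.interval T a s] s ≤ pure s := by
        rw [le_pure_iff]
        filter_upwards [self_mem_nhdsWithin, nhdsWithin_le_nhds (Ioi_mem_nhds hlt)] with x hx hx'
        by_contra hne
        exact (hsub x hx hne).2.2.not_gt hx'
      exact (tendsto_pure_nhds g s).mono_left hpure
    · refine (hg.1 s (hsub s hs hst.ne) hσ).mono_of_mem_nhdsWithin ?_
      filter_upwards [self_mem_nhdsWithin, nhdsWithin_le_nhds (Iio_mem_nhds hst)] with x hx hx'
      exact hsub x hx (ne_of_lt hx')
  · intro s hs hρ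
    have hst : s ≠ t := fun h' => h (h' ▸ hρ)
    obtain ⟨l, hl⟩ := hg.2 s (hsub s hs hst) hρ
    refine ⟨l, hl.mono_left (nhdsWithin_mono _ fun x hx => ⟨hsub x hx.1 ?_, hx.2⟩)⟩
    exact (lt_of_lt_of_le hx.2 hs.2.2).ne

/-- Allows a function controlled only on `T^κ`, such as `f`, to be integrated over all of `T`. -/
theorem rdContinuousOn_of_kappa (hT : IsScale T a b) {g : ℝ → ℝ}
    (hg : RdContinuousOn T (kappa T) g) : RdContinuousOn T T g := by
  rw [hT.kappa_eq] at hg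
  have := hT.rdContinuousOn_of_rho hT.greatest.1 hg
  rwa [hT.interval_self] at this

theorem hasDeltaDerivAt_integral (hT : IsScale T a b) {g : ℝ → ℝ} (hg : RdContinuousOn T T g)
    {s : ℝ} (hs : s ∈ T) : HasDeltaDerivAt T (fun t => integral T g a t) (g s) s := by
  have hmono : ∀ r, RdContinuousOn T (TimeScale.interval T a r) g := fun r =>
    hg.mono inter_subset_left
  have := hT.hasDeltaDerivAt_primitive
    (hT.intervalIntegrable_comp_proj hT.greatest.1 (hmono b)) hs (hg.1 s hs)
  intro ε hε
  obtain ⟨δ, hδ, H⟩ := this ε hε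
  refine ⟨δ, hδ, fun r hr hrs => ?_⟩
  simp only [hT.integral_eq (hT.sigma_mem hs) (hmono _), hT.integral_eq hr (hmono _)]
  exact H r hr hrs

theorem continuousOn_integral (hT : IsScale T a b) {g : ℝ → ℝ} (hg : RdContinuousOn T T g) :
    ContinuousOn (fun t => integral T g a t) T := fun _ hs =>
  hT.continuousWithinAt hs (hT.hasDeltaDerivAt_integral hg hs)

end IsScale

/-! ### The exponential and Grönwall's inequality -/

theorem hasDeltaDerivAt_const (c t : ℝ) : HasDeltaDerivAt T (fun _ => c) 0 t := fun ε hε =>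
  ⟨1, one_pos, fun s _ _ => by simpa using by positivity⟩

theorem HasDeltaDerivAt.const_add {F : ℝ → ℝ} {d t : ℝ} (c : ℝ) (hF : HasDeltaDerivAt T F d t) :
    HasDeltaDerivAt T (fun x => c + F x) d t := by
  simpa only [HasDeltaDerivAt, add_sub_add_left_eq_sub] using hF

/-- The cylinder transform of `f`. -/
noncomputable def cylinder (T : Set ℝ) (f : ℝ → ℝ) (t : ℝ) : ℝ :=
  if sigma T t - t = 0 then f t else Real.log (1 + f t * (sigma T t - t)) / (sigma T t - t)

/-- The time scale exponential of `f` with base point `a`, as the exponential of the integral of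
the cylinder transform of `f`. -/
noncomputable def expFun (T : Set ℝ) (a : ℝ) (f : ℝ → ℝ) (t : ℝ) : ℝ :=
  Real.exp (integral T (cylinder T f) a t)

theorem expFun_pos (f : ℝ → ℝ) (t : ℝ) : 0 < expFun T a f t := Real.exp_pos _

namespace IsScale

theorem hasDeltaDerivAt_div (hT : IsScale T a b) {F G : ℝ → ℝ} {d e t : ℝ} (ht : t ∈ T)
    (hF : HasDeltaDerivAt T F d t) (hG : HasDeltaDerivAt T G e t) (h0 : G t ≠ 0)
    (h1 : G (sigma T t) ≠ 0) :
    HasDeltaDerivAt T (fun x => F x / G x)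
      ((d * G t - F t * e) / (G t * G (sigma T t))) t := by
  rw [hT.hasDeltaDerivAt_iff ht] at hF hG ⊢
  refine ⟨fun h => ?_, fun h => ?_⟩
  · rw [h, ← sq]
    exact (hF.1 h).div (hG.1 h) h0
  · refine ⟨(hF.2 h).1.div (hG.2 h).1 h0, ?_⟩
    have hF' := (hF.2 h).2
    have hG' := (hG.2 h).2
    rw [div_add' _ _ _ h0, div_eq_div_iff h1 h0]
    field_simp
    rw [hF', hG']
    ring

theorem eq_of_hasDeltaDerivAt_zero (hT : IsScale T a b) {F : ℝ → ℝ} (hF : ContinuousOn F T)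
    (hd : ∀ t ∈ T, t < b → HasDeltaDerivAt T F 0 t) {t : ℝ} (ht : t ∈ T) : F t = F a := by
  have hS := hT.interval hT.least.1 ht (hT.least.2 ht)
  have hd' : ∀ s ∈ TimeScale.interval T a t, s < t →
      HasDeltaDerivAt (TimeScale.interval T a t) F 0 s := fun s hs hst =>
    hasDeltaDerivAt_interval ht hs.2.1 hst (hd s hs.1 (hst.trans_le (hT.greatest.2 ht)))
  have hc := hF.mono (inter_subset_left : TimeScale.interval T a t ⊆ T)
  refine le_antisymm (hS.le_of_hasDeltaDerivAt (d := fun _ => 0) hc hd' (by simp)) ?_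
  have := hS.le_of_hasDeltaDerivAt (F := fun x => 0 - F x) (d := fun _ => 0 - 0)
    (continuousOn_const.sub hc)
    (fun s hs hst => (hasDeltaDerivAt_const 0 s).sub (hd' s hs hst)) (by simp)
  linarith

theorem tendsto_graininess (hT : IsScale T a b) {t : ℝ} (ht : t ∈ T) (h : sigma T t = t) :
    Tendsto (fun s => sigma T s - s) (𝓝[T] t) (𝓝 0) := by
  rw [Metric.tendsto_nhds]
  intro ε hε
  obtain ⟨r, hrt, hev⟩ : ∃ r < t + ε / 2, ∀ᶠ s in 𝓝[T] t, sigma T s ≤ r := by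
    rcases (hT.greatest.2 ht).eq_or_lt with rfl | htb
    · refine ⟨t, by linarith, ?_⟩
      filter_upwards [self_mem_nhdsWithin] with s hs using hT.greatest.2 (hT.sigma_mem hs)
    · obtain ⟨r, hr, htr, hrε⟩ := hT.exists_gt_of_sigma_eq htb h (half_pos hε)
      refine ⟨r, hrε, ?_⟩
      filter_upwards [nhdsWithin_le_nhds (Iio_mem_nhds htr)] with s hs using sigma_le hr hs
  filter_upwards [hev, self_mem_nhdsWithin,
    nhdsWithin_le_nhds (Ioi_mem_nhds (sub_lt_self t (half_pos hε)))] with s hs hsT hst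
  have hst' : t - ε / 2 < s := hst
  rw [Real.dist_eq, sub_zero, abs_of_nonneg (sub_nonneg.2 (hT.le_sigma hsT))]
  linarith

theorem tendsto_graininess_left (hT : IsScale T a b) {t : ℝ} (ht : t ∈ T) :
    Tendsto (fun s => sigma T s - s) (𝓝[T ∩ Iio t] t) (𝓝 0) := by
  have h0 : Tendsto (fun s : ℝ => t - s) (𝓝[T ∩ Iio t] t) (𝓝 (t - t)) :=
    (Continuous.tendsto (by fun_prop) t).mono_left nhdsWithin_le_nhds
  rw [sub_self] at h0
  refine tendsto_of_tendsto_of_tendsto_of_le_of_le' tendsto_const_nhds h0 ?_ ?_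
  · filter_upwards [self_mem_nhdsWithin] with s hs using sub_nonneg.2 (hT.le_sigma hs.1)
  · filter_upwards [self_mem_nhdsWithin] with s hs using sub_le_sub_right (sigma_le ht hs.2) s

section exponential

variable {f : ℝ → ℝ}

/-- Follows from `z - z² ≤ log (1 + z) ≤ z` with `z` the product of `f t` and the graininess. It
gives the cylinder transform the same limits as `f` wherever the graininess tends to zero. -/
theorem cylinder_mem (hT : IsScale T a b) (hf0 : ∀ t ∈ kappa T, 0 ≤ f t) {t : ℝ} (ht : t ∈ T) :
    0 ≤ f t - cylinder T f t ∧ f t - cylinder T f t ≤ (sigma T t - t) * f t ^ 2 := by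
  unfold cylinder
  split_ifs with h
  · simp [h]
  · set m := sigma T t - t with hm
    have hmpos : 0 < m := (sub_nonneg.2 (hT.le_sigma ht)).lt_of_ne (Ne.symm h)
    have hft : 0 ≤ f t := hf0 t (hT.mem_kappa_of_lt ht
      ((sub_pos.1 hmpos).trans_le (hT.greatest.2 (hT.sigma_mem ht))))
    have hz : 0 ≤ f t * m := by positivity
    have hlog : Real.log (1 + f t * m) ≤ f t * m := by
      have := Real.log_le_sub_one_of_pos (x := 1 + f t * m) (by positivity)
      linarith
    have hlog' : f t * m - (f t * m) ^ 2 ≤ Real.log (1 + f t * m) := by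
      refine le_trans ?_ (Real.one_sub_inv_le_log_of_pos (x := 1 + f t * m) (by positivity))
      rw [← sub_nonneg]
      have : 1 - (1 + f t * m)⁻¹ - (f t * m - (f t * m) ^ 2) = (f t * m) ^ 3 / (1 + f t * m) := by
        field_simp
        ring
      rw [this]
      positivity
    constructor
    · rw [sub_nonneg, div_le_iff₀ hmpos]
      exact hlog
    · rw [sub_le_comm, le_div_iff₀ hmpos]
      linarith [hlog']

theorem tendsto_cylinder (hT : IsScale T a b) (hf0 : ∀ t ∈ kappa T, 0 ≤ f t) {l : Filter ℝ}
    {c : ℝ} (hl : T ∈ l) (hm : Tendsto (fun s => sigma T s - s) l (𝓝 0))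
    (hf : Tendsto f l (𝓝 c)) : Tendsto (cylinder T f) l (𝓝 c) := by
  have h1 : Tendsto (fun s => (sigma T s - s) * f s ^ 2) l (𝓝 0) := by
    simpa using hm.mul (hf.pow 2)
  have h2 : Tendsto (fun s => f s - cylinder T f s) l (𝓝 0) :=
    tendsto_of_tendsto_of_tendsto_of_le_of_le' tendsto_const_nhds h1
      (by filter_upwards [hl] with s hs using (hT.cylinder_mem hf0 hs).1)
      (by filter_upwards [hl] with s hs using (hT.cylinder_mem hf0 hs).2)
  simpa using hf.sub h2

theorem rdContinuousOn_cylinder (hT : IsScale T a b) (hf : RdContinuousOn T T f)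
    (hf0 : ∀ t ∈ kappa T, 0 ≤ f t) : RdContinuousOn T T (cylinder T f) := by
  refine ⟨fun t ht hσ => ?_, fun t ht hρ => ?_⟩
  · have : cylinder T f t = f t := if_pos (sub_eq_zero.2 hσ)
    rw [ContinuousWithinAt, this]
    exact hT.tendsto_cylinder hf0 self_mem_nhdsWithin (hT.tendsto_graininess ht hσ) (hf.1 t ht hσ)
  · obtain ⟨l, hl⟩ := hf.2 t ht hρ
    exact ⟨l, hT.tendsto_cylinder hf0 (mem_of_superset self_mem_nhdsWithin inter_subset_left)
      (hT.tendsto_graininess_left ht) hl⟩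

/-- Across a gap of length `μ` the exponent grows by `log (1 + μ f)`, so the exponential is
multiplied by exactly `1 + μ f`; at dense points this is the ordinary chain rule. -/
theorem hasDeltaDerivAt_expFun (hT : IsScale T a b) (hf : RdContinuousOn T T f)
    (hf0 : ∀ t ∈ kappa T, 0 ≤ f t) {t : ℝ} (ht : t ∈ T) :
    HasDeltaDerivAt T (expFun T a f) (f t * expFun T a f t) t := by
  have hY := hT.hasDeltaDerivAt_integral (hT.rdContinuousOn_cylinder hf hf0) ht
  rw [hT.hasDeltaDerivAt_iff ht] at hY ⊢
  refine ⟨fun h => ?_, fun h => ⟨(hY.2 h).1.rexp, ?_⟩⟩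
  · have := (hY.1 h).exp
    rwa [cylinder, if_pos (sub_eq_zero.2 h), mul_comm] at this
  · have hft : 0 ≤ f t := hf0 t (hT.mem_kappa_of_lt ht
      (h.trans_le (hT.greatest.2 (hT.sigma_mem ht))))
    have hm := sub_pos.2 h
    rw [expFun, (hY.2 h).2, cylinder, if_neg hm.ne', div_mul_cancel₀ _ hm.ne', Real.exp_add,
      Real.exp_log (by positivity), expFun]
    ring

theorem continuousOn_expFun (hT : IsScale T a b) (hf : RdContinuousOn T T f)
    (hf0 : ∀ t ∈ kappa T, 0 ≤ f t) : ContinuousOn (expFun T a f) T := fun _ ht =>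
  hT.continuousWithinAt ht (hT.hasDeltaDerivAt_expFun hf hf0 ht)

theorem expFun_least (hT : IsScale T a b) (f : ℝ → ℝ) : expFun T a f a = 1 := by
  rw [expFun, hT.integral_self, Real.exp_zero]

/-- The quotient of `z` by the exponential has derivative zero. This uniqueness makes `exp`
independent of the chosen solution. -/
theorem isExpSolution_eq (hT : IsScale T a b) (hf : RdContinuousOn T T f)
    (hf0 : ∀ t ∈ kappa T, 0 ≤ f t) {z : ℝ → ℝ} {t₀ t : ℝ} (hz : IsExpSolution T f t₀ z)
    (ht : t ∈ T) : z t = z a * expFun T a f t := by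
  have hd : ∀ s ∈ kappa T, HasDeltaDerivAt T (fun x => z x / expFun T a f x) 0 s := fun s hs => by
    have := hT.hasDeltaDerivAt_div hs.1 (hz.1 s hs) (hT.hasDeltaDerivAt_expFun hf hf0 hs.1)
      (expFun_pos f s).ne' (expFun_pos f _).ne'
    convert this using 1
    rw [eq_comm, div_eq_zero_iff]
    left; ring
  have := hT.eq_of_hasDeltaDerivAt_zero
    (hT.continuousOn_of_kappa fun s hs => hT.continuousWithinAt hs.1 (hd s hs))
    (fun s hs hsb => hd s (hT.mem_kappa_of_lt hs hsb)) ht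
  rwa [hT.expFun_least, div_one, div_eq_iff (expFun_pos f t).ne'] at this

theorem exp_eq (hT : IsScale T a b) (hf : RdContinuousOn T T f)
    (hf0 : ∀ t ∈ kappa T, 0 ≤ f t) {t t₀ : ℝ} (ht : t ∈ T) (ht₀ : t₀ ∈ T) :
    exp T f t t₀ = expFun T a f t / expFun T a f t₀ := by
  have hne := fun s => (expFun_pos (T := T) (a := a) f s).ne'
  have h : ∃ y : ℝ → ℝ, IsExpSolution T f t₀ y := by
    refine ⟨fun x => expFun T a f x / expFun T a f t₀, fun s hs => ?_, div_self (hne _)⟩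
    convert hT.hasDeltaDerivAt_div hs.1 (hT.hasDeltaDerivAt_expFun hf hf0 hs.1)
      (hasDeltaDerivAt_const (expFun T a f t₀) s) (hne t₀) (hne t₀) using 1
    have := hne t₀
    field_simp
    ring
  rw [exp, dif_pos h]
  have hz := h.choose_spec
  have h0 := hT.isExpSolution_eq hf hf0 hz ht₀
  rw [hz.2] at h0
  rw [hT.isExpSolution_eq hf hf0 hz ht, eq_div_iff (hne _), mul_right_comm, ← h0, one_mul]

/-- By the quotient rule `s ↦ -e(t)/e(s)`, with `e` the function `expFun T a f`, is an
antiderivative of `f(s) e_f(t, σ(s))`, so the integral equals `e(t) - 1`. -/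
theorem pFun_eq (hT : IsScale T a b) (hf : RdContinuousOn T T f)
    (hf0 : ∀ t ∈ kappa T, 0 ≤ f t) {t : ℝ} (ht : t ∈ T) : pFun T a f t = expFun T a f t := by
  have hne := fun s => (expFun_pos (T := T) (a := a) f s).ne'
  have har := hT.least.2 ht
  have hd : ∀ s ∈ T, HasDeltaDerivAt T (fun x => -expFun T a f t / expFun T a f x)
      (f s * exp T f t (sigma T s)) s := fun s hs => by
    convert hT.hasDeltaDerivAt_div hs (hasDeltaDerivAt_const (-expFun T a f t) s)
      (hT.hasDeltaDerivAt_expFun hf hf0 hs) (hne s) (hne _) using 1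
    rw [hT.exp_eq hf hf0 ht (hT.sigma_mem hs)]
    have := hne s
    have := hne (sigma T s)
    field_simp
    ring
  rw [pFun, hT.integral_eq_of_antideriv (F := fun x => -expFun T a f t / expFun T a f x) ht,
    hT.expFun_least, neg_div, div_self (hne t)]
  · ring
  · rw [IsAntiderivBetween, min_eq_left har, max_eq_right har]
    exact ⟨fun s hs => (hT.continuousWithinAt hs.1 (hd s hs.1)).mono inter_subset_left,
      fun s hs hst => hasDeltaDerivAt_interval ht hs.2.1 hst (hd s hs.1)⟩

/-- Grönwall's inequality. -/
theorem gronwall (hT : IsScale T a b) (hf : RdContinuousOn T T f)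
    (hf0 : ∀ t ∈ kappa T, 0 ≤ f t) {u : ℝ → ℝ} (hu : RdContinuousOn T T u) {c t : ℝ} (ht : t ∈ T)
    (h : ∀ s ∈ T, s < t → u s ≤ c + integral T (fun s => f s * u s) a s) :
    c + integral T (fun s => f s * u s) a t ≤ c * expFun T a f t := by
  have hS := hT.interval hT.least.1 ht (hT.least.2 ht)
  -- The quotient of `c + ∫ f u` by the exponential has a derivative with the sign of `f (u - (c + ∫
  -- f u))`, which is nonpositive before `t`.
  have hd : ∀ s ∈ T, _ := fun s hs => hT.hasDeltaDerivAt_div hs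
    ((hT.hasDeltaDerivAt_integral (hf.mul hu) hs).const_add c)
    (hT.hasDeltaDerivAt_expFun hf hf0 hs) (expFun_pos f s).ne' (expFun_pos f _).ne'
  have := hS.le_of_hasDeltaDerivAt
    (fun s hs => (hT.continuousWithinAt hs.1 (hd s hs.1)).mono inter_subset_left)
    (fun s hs hst => hasDeltaDerivAt_interval ht hs.2.1 hst (hd s hs.1)) fun s hs hst => by
      refine div_nonpos_of_nonpos_of_nonneg ?_ (mul_pos (expFun_pos f s) (expFun_pos f _)).le
      have h1 := hf0 s (hT.mem_kappa_of_lt hs.1 (hst.trans_le (hT.greatest.2 ht)))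
      have h2 := mul_le_mul_of_nonneg_left (h s hs.1 hst) h1
      have h3 := mul_le_mul_of_nonneg_right h2 (expFun_pos (T := T) (a := a) f s).le
      linarith
  rw [hT.expFun_least, hT.integral_self, div_one, add_zero] at this
  rwa [div_le_iff₀ (expFun_pos f t)] at this

end exponential
end IsScale

/-! ### Volterra integrals with a monotone kernel -/

/-- The Volterra integral operator `w ↦ ∫_a^t k(t,τ) w(τ) Δτ`. -/
noncomputable def volterra (T : Set ℝ) (a : ℝ) (k : ℝ → ℝ → ℝ) (w : ℝ → ℝ) (t : ℝ) : ℝ :=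
  integral T (fun τ => k t τ * w τ) a t

namespace IsDeltaKernel

variable {k kΔ : ℝ → ℝ → ℝ} {w w' : ℝ → ℝ}

theorem hasDeltaDerivAt (hk : IsDeltaKernel T a k kΔ) (hT : IsScale T a b) {t τ : ℝ}
    (ht : t ∈ kappa T) (hat : a < t) (hτ : τ ∈ T) (hτt : τ ≤ t) :
    HasDeltaDerivAt T (fun s => k s τ) (kΔ t τ) t := fun ε hε => by
  obtain ⟨δ, hδ, H⟩ := hk.deriv_fst t ht hat ε hε
  exact ⟨δ, hδ, fun s hs hst =>
    H s hs hst τ ⟨hτ, hT.least.2 hτ, hτt.trans (hT.le_sigma ht.1)⟩⟩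

theorem mono_fst (hk : IsDeltaKernel T a k kΔ) (hT : IsScale T a b)
    (hkΔ0 : ∀ t ∈ kappa T, a < t → ∀ s ∈ T, s ≤ t → 0 ≤ kΔ t s) {s t τ : ℝ} (has : a < s)
    (hs : s ∈ T) (ht : t ∈ kappa T) (hst : s ≤ t) (hτ : τ ∈ T) (hτs : τ ≤ s) :
    k s τ ≤ k t τ := by
  have hS := hT.interval hs ht.1 hst
  have hκ : ∀ x ∈ interval T s t, x ∈ kappa T := fun x hx => hT.mem_kappa_of_le ht hx.1 hx.2.2
  have hd : ∀ x ∈ interval T s t, HasDeltaDerivAt T (fun x => 0 - k x τ) (0 - kΔ x τ) x :=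
    fun x hx => (hasDeltaDerivAt_const 0 x).sub
      (hk.hasDeltaDerivAt hT (hκ x hx) (has.trans_le hx.2.1) hτ (hτs.trans hx.2.1))
  have := hS.le_of_hasDeltaDerivAt
    (fun x hx => (hT.continuousWithinAt hx.1 (hd x hx)).mono inter_subset_left)
    (fun x hx hxt => hasDeltaDerivAt_interval ht.1 hx.2.1 hxt (hd x hx)) fun x hx _ => by
      have := hkΔ0 x (hκ x hx) (has.trans_le hx.2.1) τ hτ (hτs.trans hx.2.1)
      linarith
  linarith

theorem rdContinuousOn_mul (hk : IsDeltaKernel T a k kΔ) (hT : IsScale T a b)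
    (hw : RdContinuousOn T T w) {t : ℝ} (ht : t ∈ kappa T) (hat : a < t) :
    RdContinuousOn T (interval T a t) fun τ => k t τ * w τ :=
  ((hk.rdContinuous t ht hat).mono fun _ hx =>
    ⟨hx.1, hx.2.1, hx.2.2.trans (hT.le_sigma ht.1)⟩).mul (hw.mono inter_subset_left)

theorem volterra_mono (hk : IsDeltaKernel T a k kΔ) (hT : IsScale T a b)
    (hk0 : ∀ t ∈ T, ∀ s ∈ T, s ≤ t → 0 ≤ k t s)
    (hw : RdContinuousOn T T w) (hw' : RdContinuousOn T T w') {t : ℝ} (ht : t ∈ kappa T)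
    (h : ∀ τ ∈ T, τ < t → w τ ≤ w' τ) : volterra T a k w t ≤ volterra T a k w' t := by
  -- The kernel is not assumed regular at `t = a`, but there the integrals vanish.
  rcases (hT.least.2 ht.1).eq_or_lt with rfl | hat
  · rw [volterra, volterra, hT.integral_self, hT.integral_self]
  · exact hT.integral_mono ht.1 (hk.rdContinuousOn_mul hT hw ht hat)
      (hk.rdContinuousOn_mul hT hw' ht hat) fun τ hτ hτt =>
        mul_le_mul_of_nonneg_left (h τ hτ hτt) (hk0 t ht.1 τ hτ hτt.le)

theorem volterra_add (hk : IsDeltaKernel T a k kΔ) (hT : IsScale T a b)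
    (hw : RdContinuousOn T T w) (hw' : RdContinuousOn T T w') {t : ℝ} (ht : t ∈ kappa T) :
    volterra T a k (fun τ => w τ + w' τ) t = volterra T a k w t + volterra T a k w' t := by
  rcases (hT.least.2 ht.1).eq_or_lt with rfl | hat
  · simp only [volterra, hT.integral_self, add_zero]
  · have h1 := hk.rdContinuousOn_mul hT hw ht hat
    have h2 := hk.rdContinuousOn_mul hT hw' ht hat
    rw [volterra, volterra, volterra, hT.integral_eq ht.1 h1, hT.integral_eq ht.1 h2,
      hT.integral_eq ht.1 (hk.rdContinuousOn_mul hT (hw.add hw') ht hat),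
      ← intervalIntegral.integral_add (hT.intervalIntegrable_comp_proj ht.1 h1)
        (hT.intervalIntegrable_comp_proj ht.1 h2)]
    simp only [mul_add]

theorem volterra_const_mul (hk : IsDeltaKernel T a k kΔ) (hT : IsScale T a b) (c : ℝ)
    (hw : RdContinuousOn T T w) {t : ℝ} (ht : t ∈ kappa T) :
    volterra T a k (fun τ => c * w τ) t = c * volterra T a k w t := by
  rcases (hT.least.2 ht.1).eq_or_lt with rfl | hat
  · simp only [volterra, hT.integral_self, mul_zero]
  · rw [volterra, volterra, ← hT.integral_const_mul c ht.1 (hk.rdContinuousOn_mul hT hw ht hat)]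
    simp only [mul_left_comm]

/-- The integrand of `volterra`, extended by zero to the line. -/
noncomputable def integrand (T : Set ℝ) (a : ℝ) (k : ℝ → ℝ → ℝ) (w : ℝ → ℝ) (t : ℝ) : ℝ → ℝ :=
  (Ioo a t).indicator fun x => k t (proj T x) * w (proj T x)

theorem volterra_eq (hk : IsDeltaKernel T a k kΔ) (hT : IsScale T a b)
    (hw : RdContinuousOn T T w) {t : ℝ} (ht : t ∈ kappa T) :
    volterra T a k w t = ∫ x, integrand T a k w t x := by
  rw [integrand, MeasureTheory.integral_indicator measurableSet_Ioo]
  rcases (hT.least.2 ht.1).eq_or_lt with rfl | hat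
  · simp [volterra, hT.integral_self]
  · rw [volterra, hT.integral_eq ht.1 (hk.rdContinuousOn_mul hT hw ht hat),
      intervalIntegral.integral_of_le hat.le, MeasureTheory.integral_Ioc_eq_integral_Ioo]

theorem integrable_integrand (hk : IsDeltaKernel T a k kΔ) (hT : IsScale T a b)
    (hw : RdContinuousOn T T w) {t : ℝ} (ht : t ∈ kappa T) :
    MeasureTheory.Integrable (integrand T a k w t) := by
  rw [integrand, MeasureTheory.integrable_indicator_iff measurableSet_Ioo]
  rcases (hT.least.2 ht.1).eq_or_lt with rfl | hat
  · simp
  · exact (intervalIntegrable_iff_integrableOn_Ioo_of_le hat.le).1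
      (hT.intervalIntegrable_comp_proj ht.1 (hk.rdContinuousOn_mul hT hw ht hat))

theorem integrand_nonneg (hT : IsScale T a b) (hk0 : ∀ t ∈ T, ∀ s ∈ T, s ≤ t → 0 ≤ k t s)
    {t : ℝ} (ht : t ∈ T) (hw0 : ∀ τ ∈ T, τ < t → 0 ≤ w τ) (x : ℝ) :
    0 ≤ integrand T a k w t x := by
  refine indicator_nonneg (fun x hx => ?_) x
  have h1 := hT.proj_mem hx.1.le
  have h2 := (hT.proj_le hx.1.le).trans_lt hx.2
  exact mul_nonneg (hk0 t ht _ h1 h2.le) (hw0 _ h1 h2)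

theorem integrand_mono (hk : IsDeltaKernel T a k kΔ) (hT : IsScale T a b)
    (hk0 : ∀ t ∈ T, ∀ s ∈ T, s ≤ t → 0 ≤ k t s)
    (hkΔ0 : ∀ t ∈ kappa T, a < t → ∀ s ∈ T, s ≤ t → 0 ≤ kΔ t s)
    {s t : ℝ} (hs : s ∈ T) (ht : t ∈ kappa T) (hst : s ≤ t) (hw0 : ∀ τ ∈ T, τ < t → 0 ≤ w τ)
    (x : ℝ) : integrand T a k w s x ≤ integrand T a k w t x := by
  by_cases hx : x ∈ Ioo a s
  · have h1 := hT.proj_mem hx.1.le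
    have h2 := (hT.proj_le hx.1.le).trans_lt hx.2
    rw [integrand, integrand, indicator_of_mem hx, indicator_of_mem (Ioo_subset_Ioo_right hst hx)]
    exact mul_le_mul_of_nonneg_right
      (hk.mono_fst hT hkΔ0 (hx.1.trans hx.2) hs ht hst h1 h2.le) (hw0 _ h1 (h2.trans_le hst))
  · exact (indicator_of_notMem hx _).trans_le (integrand_nonneg hT hk0 ht.1 hw0 x)

/-- Both the kernel and the domain of integration grow with the upper variable. Nonnegativity of `w`
is asked only before `t`, since the Bihari step uses a weight whose sign is known only there. -/
theorem volterra_le_volterra (hk : IsDeltaKernel T a k kΔ) (hT : IsScale T a b)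
    (hk0 : ∀ t ∈ T, ∀ s ∈ T, s ≤ t → 0 ≤ k t s)
    (hkΔ0 : ∀ t ∈ kappa T, a < t → ∀ s ∈ T, s ≤ t → 0 ≤ kΔ t s)
    (hw : RdContinuousOn T T w) {s t : ℝ} (hs : s ∈ kappa T) (ht : t ∈ kappa T) (hst : s ≤ t)
    (hw0 : ∀ τ ∈ T, τ < t → 0 ≤ w τ) : volterra T a k w s ≤ volterra T a k w t := by
  rw [hk.volterra_eq hT hw hs, hk.volterra_eq hT hw ht]
  exact MeasureTheory.integral_mono (hk.integrable_integrand hT hw hs)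
    (hk.integrable_integrand hT hw ht) (hk.integrand_mono hT hk0 hkΔ0 hs.1 ht hst hw0)

theorem volterra_monotoneOn (hk : IsDeltaKernel T a k kΔ) (hT : IsScale T a b)
    (hk0 : ∀ t ∈ T, ∀ s ∈ T, s ≤ t → 0 ≤ k t s)
    (hkΔ0 : ∀ t ∈ kappa T, a < t → ∀ s ∈ T, s ≤ t → 0 ≤ kΔ t s)
    (hw : RdContinuousOn T T w) (hw0 : ∀ t ∈ kappa T, 0 ≤ w t) :
    MonotoneOn (volterra T a k w) (kappa T) := fun _ hs _ ht hst =>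
  hk.volterra_le_volterra hT hk0 hkΔ0 hw hs ht hst fun τ hτ hτt =>
    hw0 τ (hT.mem_kappa_of_le ht hτ hτt.le)

theorem volterra_least (hT : IsScale T a b) : volterra T a k w a = 0 := hT.integral_self _

theorem volterra_nonneg (hk : IsDeltaKernel T a k kΔ) (hT : IsScale T a b)
    (hk0 : ∀ t ∈ T, ∀ s ∈ T, s ≤ t → 0 ≤ k t s) (hw : RdContinuousOn T T w)
    (hw0 : ∀ t ∈ kappa T, 0 ≤ w t) {t : ℝ} (ht : t ∈ kappa T) : 0 ≤ volterra T a k w t := by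
  rw [hk.volterra_eq hT hw ht]
  exact MeasureTheory.integral_nonneg (integrand_nonneg hT hk0 ht.1 fun τ hτ hτt =>
    hw0 τ (hT.mem_kappa_of_le ht hτ hτt.le))

/-- Dominated convergence: the integrand for `ρ(b)`, the maximum of `T^κ`, dominates all others, and
`Δ`-differentiability makes `k(·,τ)` continuous. The jump of the indicator at `x = t` is a null set.
-/
theorem continuousOn_volterra (hk : IsDeltaKernel T a k kΔ) (hT : IsScale T a b)
    (hk0 : ∀ t ∈ T, ∀ s ∈ T, s ≤ t → 0 ≤ k t s)
    (hkΔ0 : ∀ t ∈ kappa T, a < t → ∀ s ∈ T, s ≤ t → 0 ≤ kΔ t s)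
    (hw : RdContinuousOn T T w) (hw0 : ∀ t ∈ kappa T, 0 ≤ w t) :
    ContinuousOn (volterra T a k w) (kappa T) := by
  have hρ := hT.rho_mem_kappa hT.greatest.1
  have hw0' : ∀ s ∈ kappa T, ∀ τ ∈ T, τ < s → 0 ≤ w τ := fun s hs τ hτ hτs =>
    hw0 τ (hT.mem_kappa_of_le hs hτ hτs.le)
  have hev : ∀ t, ∀ᶠ s in 𝓝[kappa T] t, s ∈ kappa T := fun t => self_mem_nhdsWithin
  intro t ht
  rw [ContinuousWithinAt, hk.volterra_eq hT hw ht]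
  refine (MeasureTheory.tendsto_integral_filter_of_dominated_convergence
    (F := integrand T a k w) (integrand T a k w (rho T b)) ?_ ?_
    (hk.integrable_integrand hT hw hρ) ?_).congr' ?_
  · filter_upwards [hev t] with s hs using (hk.integrable_integrand hT hw hs).1
  · filter_upwards [hev t] with s hs
    refine .of_forall fun x => ?_
    rw [Real.norm_of_nonneg (integrand_nonneg hT hk0 hs.1 (hw0' s hs) x)]
    rw [hT.kappa_eq] at hs
    exact hk.integrand_mono hT hk0 hkΔ0 hs.1 hρ hs.2.2 (hw0' _ hρ) x
  · have hne : ∀ᵐ x : ℝ, x ≠ t := MeasureTheory.Measure.ae_ne MeasureTheory.volume t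
    filter_upwards [hne] with x hxt
    rcases le_or_gt x a with hxa | hax
    · have : ∀ s, integrand T a k w s x = 0 := fun s =>
        indicator_of_notMem (fun h => h.1.not_ge hxa) _
      simp only [this, tendsto_const_nhds]
    · rcases hxt.lt_or_gt with h | h
      · have hτ := hT.proj_mem hax.le
        have hτt := (hT.proj_le hax.le).trans h.le
        have hc : Tendsto (fun s => k s (proj T x)) (𝓝[kappa T] t) (𝓝 (k t (proj T x))) :=
          (hT.continuousWithinAt ht.1
            (hk.hasDeltaDerivAt hT ht (hax.trans h) hτ hτt)).mono_left
              (nhdsWithin_mono _ fun _ hs => hs.1)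
        rw [integrand, indicator_of_mem (show x ∈ Ioo a t from ⟨hax, h⟩)]
        refine (hc.mul_const _).congr' ?_
        filter_upwards [nhdsWithin_le_nhds (Ioi_mem_nhds h)] with s hs
        rw [integrand, indicator_of_mem (show x ∈ Ioo a s from ⟨hax, hs⟩)]
      · rw [integrand, indicator_of_notMem fun hx => hx.2.not_gt h]
        refine tendsto_const_nhds.congr' ?_
        filter_upwards [nhdsWithin_le_nhds (Iio_mem_nhds h)] with s hs
        rw [integrand, indicator_of_notMem fun hx => hx.2.not_gt hs]
  · filter_upwards [hev t] with s hs using (hk.volterra_eq hT hw hs).symm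

end IsDeltaKernel

/-! ### The function `Ψ` and Bihari's inequality -/

variable {Φ W : ℝ → ℝ} {x₀ : ℝ}

theorem intervalIntegrable_Psi (hc : ContinuousOn (fun x => Φ (W x)) (Ici 0))
    (hpos : ∀ x, 0 < x → 0 < Φ (W x)) {x y : ℝ} (hx : 0 < x) (hy : 0 < y) :
    IntervalIntegrable (fun s => 1 / Φ (W s)) MeasureTheory.volume x y := by
  have h : ∀ s ∈ uIcc x y, 0 < s := fun s hs => (lt_min hx hy).trans_le hs.1
  exact (continuousOn_const.div (hc.mono fun s hs => (h s hs).le)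
    fun s hs => (hpos s (h s hs)).ne').intervalIntegrable

theorem Psi_sub_Psi (hc : ContinuousOn (fun x => Φ (W x)) (Ici 0))
    (hpos : ∀ x, 0 < x → 0 < Φ (W x)) (hx₀ : 0 < x₀) {x y : ℝ} (hx : 0 < x) (hy : 0 < y) :
    Psi Φ W x₀ y - Psi Φ W x₀ x = ∫ s in x..y, 1 / Φ (W s) :=
  intervalIntegral.integral_interval_sub_left (intervalIntegrable_Psi hc hpos hx₀ hy)
    (intervalIntegrable_Psi hc hpos hx₀ hx)

theorem Psi_sub_Psi_le (hc : ContinuousOn (fun x => Φ (W x)) (Ici 0))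
    (hm : MonotoneOn (fun x => Φ (W x)) (Ici 0)) (hpos : ∀ x, 0 < x → 0 < Φ (W x))
    (hx₀ : 0 < x₀) {x y : ℝ} (hx : 0 < x) (hxy : x ≤ y) :
    Psi Φ W x₀ y - Psi Φ W x₀ x ≤ (y - x) / Φ (W x) := by
  rw [Psi_sub_Psi hc hpos hx₀ hx (hx.trans_le hxy)]
  have := intervalIntegral.integral_mono_on_of_le_Ioo (g := fun _ => 1 / Φ (W x)) hxy
    (intervalIntegrable_Psi hc hpos hx (hx.trans_le hxy)) intervalIntegrable_const fun s hs =>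
      one_div_le_one_div_of_le (hpos x hx) (hm hx.le (hx.trans hs.1).le hs.1.le)
  rwa [intervalIntegral.integral_const, smul_eq_mul, mul_one_div] at this

theorem Psi_strictMonoOn (hc : ContinuousOn (fun x => Φ (W x)) (Ici 0))
    (hpos : ∀ x, 0 < x → 0 < Φ (W x)) (hx₀ : 0 < x₀) :
    StrictMonoOn (Psi Φ W x₀) (Ioi 0) := by
  intro x hx y hy hxy
  rw [← sub_pos, Psi_sub_Psi hc hpos hx₀ hx hy]
  exact intervalIntegral.intervalIntegral_pos_of_pos_on (intervalIntegrable_Psi hc hpos hx hy)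
    (fun s hs => one_div_pos.2 (hpos s (lt_trans hx hs.1))) hxy

theorem continuousOn_Psi (hc : ContinuousOn (fun x => Φ (W x)) (Ici 0))
    (hpos : ∀ x, 0 < x → 0 < Φ (W x)) (hx₀ : 0 < x₀) :
    ContinuousOn (Psi Φ W x₀) (Ioi 0) := by
  intro x hx
  have hx' : (0 : ℝ) < x := hx
  have hmin := lt_min hx₀ (half_pos hx')
  have hmax : 0 < max x₀ (2 * x) := hx₀.trans_le (le_max_left _ _)
  have := intervalIntegral.continuousOn_primitive_interval'
    (intervalIntegrable_Psi hc hpos hmin hmax) (a := x₀)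
    ⟨(min_le_left _ _).trans (min_le_left _ _), (le_max_left _ _).trans (le_max_right _ _)⟩
  refine (this.continuousAt ?_).continuousWithinAt
  refine mem_of_superset (Icc_mem_nhds (half_lt_self hx') (by linarith : x < 2 * x)) fun y hy => ?_
  exact ⟨(min_le_left _ _).trans ((min_le_right _ _).trans hy.1),
    hy.2.trans ((le_max_right _ _).trans (le_max_right _ _))⟩

theorem PsiInv_pos {z : ℝ} (hz : z ∈ domPsiInv Φ W x₀) : 0 < PsiInv Φ W x₀ z :=
  Function.invFunOn_mem hz

theorem Psi_PsiInv {z : ℝ} (hz : z ∈ domPsiInv Φ W x₀) : Psi Φ W x₀ (PsiInv Φ W x₀ z) = z :=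
  Function.invFunOn_eq hz

theorem ordConnected_domPsiInv (hc : ContinuousOn (fun x => Φ (W x)) (Ici 0))
    (hpos : ∀ x, 0 < x → 0 < Φ (W x)) (hx₀ : 0 < x₀) : (domPsiInv Φ W x₀).OrdConnected :=
  (isPreconnected_Ioi.image _ (continuousOn_Psi hc hpos hx₀)).ordConnected

theorem le_PsiInv (hc : ContinuousOn (fun x => Φ (W x)) (Ici 0))
    (hpos : ∀ x, 0 < x → 0 < Φ (W x)) (hx₀ : 0 < x₀) {x z : ℝ} (hx : 0 < x)
    (hz : z ∈ domPsiInv Φ W x₀) (h : Psi Φ W x₀ x ≤ z) : x ≤ PsiInv Φ W x₀ z := by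
  rwa [← (Psi_strictMonoOn hc hpos hx₀).le_iff_le hx (PsiInv_pos hz), Psi_PsiInv hz]

theorem continuousOn_PsiInv (hc : ContinuousOn (fun x => Φ (W x)) (Ici 0))
    (hpos : ∀ x, 0 < x → 0 < Φ (W x)) (hx₀ : 0 < x₀) :
    ContinuousOn (PsiInv Φ W x₀) (domPsiInv Φ W x₀) := by
  have hmono := Psi_strictMonoOn hc hpos hx₀
  have hinv : ∀ x, 0 < x → PsiInv Φ W x₀ (Psi Φ W x₀ x) = x := fun x hx =>
    hmono.injOn (PsiInv_pos ⟨x, hx, rfl⟩) hx (Psi_PsiInv ⟨x, hx, rfl⟩)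
  rintro _ ⟨x, hx, rfl⟩
  have hx' : (0 : ℝ) < x := hx
  have hmono' : StrictMonoOn (PsiInv Φ W x₀) (domPsiInv Φ W x₀) := fun z hz z' hz' h => by
    rwa [← hmono.lt_iff_lt (PsiInv_pos hz) (PsiInv_pos hz'), Psi_PsiInv hz, Psi_PsiInv hz']
  refine (hmono'.continuousAt_of_image_mem_nhds ?_ ?_).continuousWithinAt
  · have h1 : x / 2 ∈ Ioi (0 : ℝ) := half_pos hx'
    have h2 : 2 * x ∈ Ioi (0 : ℝ) := mul_pos two_pos hx'
    exact mem_of_superset (Icc_mem_nhds (hmono h1 hx (half_lt_self hx'))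
      (hmono hx h2 (by linarith)))
      ((ordConnected_domPsiInv hc hpos hx₀).out ⟨_, h1, rfl⟩ ⟨_, h2, rfl⟩)
  · rw [hinv x hx]
    exact mem_of_superset (Ioi_mem_nhds hx') fun y hy => ⟨_, ⟨y, hy, rfl⟩, hinv y hy⟩

/-- Bihari's inequality, for an inequality between increments. -/
theorem IsScale.bihari (hT : IsScale T a b) (hc : ContinuousOn (fun x => Φ (W x)) (Ici 0))
    (hm : MonotoneOn (fun x => Φ (W x)) (Ici 0)) (hpos : ∀ x, 0 < x → 0 < Φ (W x))
    (hx₀ : 0 < x₀) {v I : ℝ → ℝ} (hv : ContinuousOn v T) (hI : ContinuousOn I T)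
    (hvm : MonotoneOn v T) (hIm : MonotoneOn I T) (hva : 0 < v a)
    (h : ∀ c ∈ T, ∀ s ∈ T, c ≤ s → ∀ M, (∀ τ ∈ T, τ < s → Φ (W (v τ)) ≤ M) →
      v s - v c ≤ M * (I s - I c)) :
    Psi Φ W x₀ (v b) ≤ Psi Φ W x₀ (v a) + (I b - I a) := by
  have hv0 : ∀ t ∈ T, 0 < v t := fun t ht => hva.trans_le (hvm hT.least.1 ht (hT.least.2 ht))
  -- The factor `1 + ε` leaves room for `Φ(W(v))` to exceed its value at `c` slightly over a short
  -- step to the right.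
  suffices H : ∀ ε > 0, Psi Φ W x₀ (v b) ≤ Psi Φ W x₀ (v a) + (1 + ε) * (I b - I a) by
    have hlim : Tendsto (fun ε : ℝ => Psi Φ W x₀ (v a) + (1 + ε) * (I b - I a)) (𝓝[>] 0)
        (𝓝 (Psi Φ W x₀ (v a) + (1 + 0) * (I b - I a))) :=
      Continuous.tendsto (by fun_prop) 0 |>.mono_left nhdsWithin_le_nhds
    have := ge_of_tendsto hlim (b := Psi Φ W x₀ (v b))
      (by filter_upwards [self_mem_nhdsWithin] with ε hε using H ε hε)
    simpa using this
  intro ε hε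
  have hC : IsClosed {t ∈ T | Psi Φ W x₀ (v t) ≤ Psi Φ W x₀ (v a) + (1 + ε) * (I t - I a)} :=
    hT.closed.isClosed_le ((continuousOn_Psi hc hpos hx₀).comp hv hv0) (by fun_prop)
  refine (hT.induction (fun x hx => hx.1) hC ⟨hT.least.1, by simp⟩ ?_).2
  rintro c ⟨hcT, hcC⟩ hcb
  have hωc := hpos _ (hv0 c hcT)
  have hωm : ∀ s ∈ T, ∀ t ∈ T, s ≤ t → Φ (W (v s)) ≤ Φ (W (v t)) := fun s hs t ht hst =>
    hm (hv0 s hs).le (hv0 t ht).le (hvm hs ht hst)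
  -- At a right-dense `c`, continuity gives a nearby `s`. At a right-scattered one, `s = σ(c)`
  -- works, because every point before `σ(c)` is at most `c`.
  obtain ⟨s, hs, hcs, M, hM, hMc⟩ : ∃ s ∈ T, c < s ∧ ∃ M, (∀ τ ∈ T, τ < s → Φ (W (v τ)) ≤ M) ∧
      M ≤ (1 + ε) * Φ (W (v c)) := by
    rcases (hT.le_sigma hcT).eq_or_lt with h' | h'
    · have hcont : ContinuousWithinAt (fun t => Φ (W (v t))) T c :=
        (hc _ (hv0 c hcT).le).comp (hv c hcT) fun t ht => (hv0 t ht).le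
      have hlt : Φ (W (v c)) < (1 + ε) * Φ (W (v c)) := by nlinarith
      have hev := hcont.eventually (Iio_mem_nhds hlt)
      obtain ⟨δ, hδ, H⟩ := Metric.nhdsWithin_basis_ball.eventually_iff.1 hev
      obtain ⟨s, hs, hcs, hsδ⟩ := hT.exists_gt_of_sigma_eq hcb h'.symm hδ
      refine ⟨s, hs, hcs, Φ (W (v s)), fun τ hτ hτs => hωm τ hτ s hs hτs.le,
        le_of_lt (H ⟨?_, hs⟩)⟩
      rw [Metric.mem_ball, Real.dist_eq, abs_of_pos] <;> linarith
    · refine ⟨_, hT.sigma_mem hcT, h', Φ (W (v c)), fun τ hτ hτσ => hωm τ hτ c hcT ?_, ?_⟩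
      · exact not_lt.1 fun hlt => (sigma_le hτ hlt).not_gt hτσ
      · nlinarith
  refine ⟨s, ⟨hs, ?_⟩, hcs⟩
  have h1 := Psi_sub_Psi_le hc hm hpos hx₀ (hv0 c hcT) (hvm hcT hs hcs.le)
  have h2 : (v s - v c) / Φ (W (v c)) ≤ (1 + ε) * (I s - I c) := by
    rw [div_le_iff₀ hωc]
    have h3 := sub_nonneg.2 (hIm hcT hs hcs.le)
    calc v s - v c ≤ M * (I s - I c) := h c hcT s hs hcs.le M hM
      _ ≤ (1 + ε) * Φ (W (v c)) * (I s - I c) := mul_le_mul_of_nonneg_right hMc h3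
      _ = _ := by ring
  linarith

/-- Grönwall's inequality for the zero function with constant `1`. -/
theorem IsScale.one_le_expFun (hT : IsScale T a b) {f : ℝ → ℝ} (hf : RdContinuousOn T T f)
    (hf0 : ∀ t ∈ kappa T, 0 ≤ f t) {t : ℝ} (ht : t ∈ T) : 1 ≤ expFun T a f t := by
  have h0 : RdContinuousOn T T fun _ => (0 : ℝ) := .of_continuousOn continuousOn_const
  have hn : ∀ s ∈ T, 0 ≤ integral T (fun s => f s * 0) a s := fun s hs =>
    hT.integral_nonneg hs ((hf.mul h0).mono inter_subset_left) (by simp)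
  have := hT.gronwall hf hf0 h0 (c := 1) ht fun s hs _ => by linarith [hn s hs]
  linarith [hn t ht]

/-- If `∫_a^{ρ(b)} k(ρ(b),τ) m(τ) Δτ = 0` for some `m` bounded away from zero, all integrals of
nonnegative functions against the kernel vanish. -/
theorem IsDeltaKernel.volterra_eq_zero {k kΔ : ℝ → ℝ → ℝ} (hk : IsDeltaKernel T a k kΔ)
    (hT : IsScale T a b) (hk0 : ∀ t ∈ T, ∀ s ∈ T, s ≤ t → 0 ≤ k t s)
    (hkΔ0 : ∀ t ∈ kappa T, a < t → ∀ s ∈ T, s ≤ t → 0 ≤ kΔ t s) {m w : ℝ → ℝ} {c : ℝ}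
    (hc : 0 < c) (hm : RdContinuousOn T T m) (hcm : ∀ t ∈ T, c ≤ m t)
    (hz : volterra T a k m (rho T b) = 0) (hw : RdContinuousOn T T w)
    (hw0 : ∀ t ∈ kappa T, 0 ≤ w t) {t : ℝ} (ht : t ∈ kappa T) : volterra T a k w t = 0 := by
  obtain ⟨M, hM⟩ := hT.exists_bound hT.greatest.1 (hw.mono inter_subset_left)
  rw [hT.interval_self] at hM
  have hM0 : 0 ≤ M := (abs_nonneg _).trans (hM a hT.least.1)
  refine le_antisymm ?_ (hk.volterra_nonneg hT hk0 hw hw0 ht)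
  have h1 : volterra T a k w t ≤ volterra T a k (fun τ => M / c * m τ) t :=
    hk.volterra_mono hT hk0 hw (hm.const_mul _) ht fun τ hτ _ => by
      calc w τ ≤ M := (le_abs_self _).trans (hM τ hτ)
        _ = M / c * c := by field_simp
        _ ≤ M / c * m τ := mul_le_mul_of_nonneg_left (hcm τ hτ) (by positivity)
  have ht' := ht
  rw [hT.kappa_eq] at ht'
  have h2 := hk.volterra_monotoneOn hT hk0 hkΔ0 hm
    (fun s hs => hc.le.trans (hcm s hs.1)) ht (hT.rho_mem_kappa hT.greatest.1) ht'.2.2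
  rw [hk.volterra_const_mul hT _ hm ht] at h1
  rw [hz] at h2
  exact h1.trans (mul_nonpos_of_nonneg_of_nonpos (by positivity) h2)

/-- A Volterra–Bihari inequality: `g ≤ v` with `v(t) = ζ + ∫_a^t k(t,τ) q(τ) Φ(W(g(τ))) Δτ`. -/
theorem IsDeltaKernel.bihari {k kΔ : ℝ → ℝ → ℝ} (hk : IsDeltaKernel T a k kΔ)
    (hT : IsScale T a b) (hk0 : ∀ t ∈ T, ∀ s ∈ T, s ≤ t → 0 ≤ k t s)
    (hkΔ0 : ∀ t ∈ kappa T, a < t → ∀ s ∈ T, s ≤ t → 0 ≤ kΔ t s) {Φ W : ℝ → ℝ} {x₀ ζ : ℝ}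
    (hc : ContinuousOn (fun x => Φ (W x)) (Ici 0)) (hm : MonotoneOn (fun x => Φ (W x)) (Ici 0))
    (hpos : ∀ x, 0 < x → 0 < Φ (W x)) (hnn : ∀ x, 0 ≤ x → 0 ≤ Φ (W x)) (hx₀ : 0 < x₀)
    (hζ : 0 < ζ) {g q : ℝ → ℝ} (hq : RdContinuousOn T T q) (hq0 : ∀ t ∈ kappa T, 0 ≤ q t)
    (hg : RdContinuousOn T T fun τ => Φ (W (g τ))) (hg0 : ∀ t ∈ kappa T, 0 ≤ g t)
    (hgv : ∀ t ∈ kappa T, g t ≤ ζ + volterra T a k (fun τ => q τ * Φ (W (g τ))) t)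
    {t : ℝ} (ht : t ∈ kappa T) :
    Psi Φ W x₀ (ζ + volterra T a k (fun τ => q τ * Φ (W (g τ))) t) ≤
      Psi Φ W x₀ ζ + volterra T a k q t := by
  have hh := hq.mul hg
  have hh0 : ∀ τ ∈ kappa T, 0 ≤ q τ * Φ (W (g τ)) := fun τ hτ =>
    mul_nonneg (hq0 τ hτ) (hnn _ (hg0 τ hτ))
  have hsub : interval T a t ⊆ kappa T := fun s hs => hT.mem_kappa_of_le ht hs.1 hs.2.2
  have hS := hT.interval hT.least.1 ht.1 (hT.least.2 ht.1)
  have := hS.bihari (v := fun s => ζ + volterra T a k (fun τ => q τ * Φ (W (g τ))) s) hc hm hpos hx₀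
    (continuousOn_const.add ((hk.continuousOn_volterra hT hk0 hkΔ0 hh hh0).mono hsub))
    ((hk.continuousOn_volterra hT hk0 hkΔ0 hq hq0).mono hsub)
    (fun s hs r hr hsr => add_le_add_right
      (hk.volterra_monotoneOn hT hk0 hkΔ0 hh hh0 (hsub hs) (hsub hr) hsr) ζ)
    ((hk.volterra_monotoneOn hT hk0 hkΔ0 hq hq0).mono hsub)
    (by rwa [IsDeltaKernel.volterra_least hT, add_zero]) ?_
  · simpa only [IsDeltaKernel.volterra_least hT, add_zero, sub_zero] using this
  intro c hcT s hsT hcs M hM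
  have hsκ := hsub hsT
  have hcκ := hsub hcT
  -- As `g ≤ v`, the bound `M` for `Φ(W(v))` before `s` also bounds `Φ(W(g))`. The weight `M q - q
  -- Φ(W(g))` is thus nonnegative there, and the growth of its Volterra integral from `c` to `s` is
  -- the required inequality between increments.
  have hbd : ∀ τ ∈ T, τ < s → 0 ≤ M * q τ + -1 * (q τ * Φ (W (g τ))) := fun τ hτ hτs => by
    have hτκ := hT.mem_kappa_of_le hsκ hτ hτs.le
    have h1 := hgv τ hτκ
    have h2 : Φ (W (g τ)) ≤ M := (hm (hg0 τ hτκ) ((hg0 τ hτκ).trans h1) h1).trans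
      (hM τ ⟨hτ, hT.least.2 hτ, hτs.le.trans hsT.2.2⟩ hτs)
    linarith [mul_le_mul_of_nonneg_left h2 (hq0 τ hτκ)]
  have := hk.volterra_le_volterra hT hk0 hkΔ0 ((hq.const_mul M).add (hh.const_mul (-1)))
    hcκ hsκ hcs hbd
  simp only [hk.volterra_add hT (hq.const_mul M) (hh.const_mul (-1)) hcκ,
    hk.volterra_add hT (hq.const_mul M) (hh.const_mul (-1)) hsκ,
    hk.volterra_const_mul hT _ hq hcκ, hk.volterra_const_mul hT _ hh hcκ,
    hk.volterra_const_mul hT _ hq hsκ, hk.volterra_const_mul hT _ hh hsκ] at this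
  linarith

end TimeScale

/-! ### The main theorem -/

theorem mainTheorem10
    (T : Set ℝ) (hT : IsClosed T) (a b : ℝ) (ha : a ∈ T) (hb : b ∈ T) (hab : a ≤ b)
    (Ts : Set ℝ) (hTs : Ts = TimeScale.interval T a b)
    (u f A : ℝ → ℝ) (k kΔ : ℝ → ℝ → ℝ) (Φ W : ℝ → ℝ) (x₀ : ℝ)
    (hu : TimeScale.RdContinuousOn Ts Ts u) (hu0 : ∀ t ∈ Ts, 0 ≤ u t)
    (hf : TimeScale.RdContinuousOn Ts (TimeScale.kappa Ts) f)
    (hf0 : ∀ t ∈ TimeScale.kappa Ts, 0 ≤ f t)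
    (hk : TimeScale.IsDeltaKernel Ts a k kΔ)
    (hk0 : ∀ t ∈ Ts, ∀ s ∈ Ts, s ≤ t → 0 ≤ k t s)
    (hkΔ0 : ∀ t ∈ TimeScale.kappa Ts, a < t → ∀ s ∈ Ts, s ≤ t → 0 ≤ kΔ t s)
    (hkne : ∃ t ∈ TimeScale.kappa Ts, ∃ s ∈ TimeScale.kappa (TimeScale.kappa Ts), k t s ≠ 0)
    (hΦc : ContinuousOn Φ (Set.Ici 0)) (hΦ0 : ∀ x, 0 ≤ x → 0 ≤ Φ x)
    (hΦm : MonotoneOn Φ (Set.Ici 0))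
    (hΦadd : ∀ x y, 0 ≤ x → 0 ≤ y → Φ (x + y) ≤ Φ x + Φ y)
    (hΦmul : ∀ x y, 0 ≤ x → 0 ≤ y → Φ (x * y) ≤ Φ x * Φ y)
    (hΦpos : ∀ x, 0 < x → 0 < Φ x)
    (hWc : ContinuousOn W (Set.Ici 0)) (hW0 : ∀ x, 0 ≤ x → 0 ≤ W x)
    (hWm : MonotoneOn W (Set.Ici 0)) (hWpos : ∀ x, 0 < x → 0 < W x)
    (hA : TimeScale.RdContinuousOn Ts Ts A) (hApos : ∀ t ∈ Ts, 0 < A t) (hAm : MonotoneOn A Ts)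
    (hx₀ : 0 < x₀)
    (hineq : ∀ t ∈ Ts,
      u t ≤ A t + TimeScale.integral Ts (fun s => f s * u s) a t
        + TimeScale.integral Ts
            (fun s => f s * W (TimeScale.integral Ts (fun τ => k s τ * Φ (u τ)) a s)) a t) :
    ∀ t ∈ Ts,
      TimeScale.Psi Φ W x₀ (TimeScale.zeta Ts a b f A Φ k)
          + TimeScale.kernelTerm Ts a f Φ k (TimeScale.rho Ts t) ∈ TimeScale.domPsiInv Φ W x₀ →
      u t ≤ TimeScale.pFun Ts a f t * A t
        + TimeScale.pFun Ts a f t *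
          TimeScale.integral Ts
            (fun s => f s * W (TimeScale.PsiInv Φ W x₀
              (TimeScale.Psi Φ W x₀ (TimeScale.zeta Ts a b f A Φ k)
                + TimeScale.kernelTerm Ts a f Φ k s))) a t := by
  have hS : TimeScale.IsScale Ts a b := by
    rw [hTs]
    exact ⟨hT.inter isClosed_Icc, ⟨⟨ha, le_rfl, hab⟩, fun _ hx => hx.2.1⟩,
      ⟨⟨hb, hab, le_rfl⟩, fun _ hx => hx.2.2⟩⟩
  clear hTs hkne ha hb hT
  have hfT := hS.rdContinuousOn_of_kappa hf
  have hκ : ∀ {t}, t ∈ TimeScale.kappa Ts → t ∈ Ts := fun h => h.1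
  have hρκ := hS.rho_mem_kappa hS.greatest.1
  have haκ := hS.least_mem_kappa
  -- The exponential `p` and the primitive `F` of `f`.
  set p := TimeScale.expFun Ts a f with hp
  have hp1 : ∀ t ∈ Ts, 1 ≤ p t := fun t ht => hS.one_le_expFun hfT hf0 ht
  have hp0 : ∀ t ∈ Ts, 0 ≤ p t := fun t ht => zero_le_one.trans (hp1 t ht)
  have hpc : TimeScale.RdContinuousOn Ts Ts p := .of_continuousOn (hS.continuousOn_expFun hfT hf0)
  set F : ℝ → ℝ := fun t => TimeScale.integral Ts f a t with hF
  have hF0 : ∀ t ∈ Ts, 0 ≤ F t := fun t ht =>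
    hS.integral_nonneg ht (hfT.mono Set.inter_subset_left) fun s hs hst =>
      hf0 s (hS.mem_kappa_of_lt hs (hst.trans_le (hS.greatest.2 ht)))
  have hFc : TimeScale.RdContinuousOn Ts Ts F := .of_continuousOn (hS.continuousOn_integral hfT)
  -- The weights occurring in the kernel integrals.
  set m : ℝ → ℝ := fun τ => Φ (p τ * A τ) with hm
  have hpA0 : ∀ t ∈ Ts, 0 ≤ p t * A t := fun t ht => mul_nonneg (hp0 t ht) (hApos t ht).le
  have hmc : TimeScale.RdContinuousOn Ts Ts m := (hpc.mul hA).comp hΦc hpA0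
  have hm0 : ∀ t ∈ TimeScale.kappa Ts, 0 ≤ m t := fun t ht => hΦ0 _ (hpA0 t ht.1)
  set q : ℝ → ℝ := fun τ => Φ (p τ) * Φ (F τ) with hq
  have hqc : TimeScale.RdContinuousOn Ts Ts q := (hpc.comp hΦc hp0).mul (hFc.comp hΦc hF0)
  have hq0 : ∀ t ∈ TimeScale.kappa Ts, 0 ≤ q t := fun t ht =>
    mul_nonneg (hΦ0 _ (hp0 t ht.1)) (hΦ0 _ (hF0 t ht.1))
  have hΦuc : TimeScale.RdContinuousOn Ts Ts fun τ => Φ (u τ) := hu.comp hΦc hu0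
  have hΦu0 : ∀ t ∈ TimeScale.kappa Ts, 0 ≤ Φ (u t) := fun t ht => hΦ0 _ (hu0 t ht.1)
  set g := TimeScale.volterra Ts a k fun τ => Φ (u τ) with hg
  have hgm : MonotoneOn g (TimeScale.kappa Ts) :=
    hk.volterra_monotoneOn hS hk0 hkΔ0 hΦuc hΦu0
  have hg0 : ∀ t ∈ TimeScale.kappa Ts, 0 ≤ g t := fun t ht =>
    hk.volterra_nonneg hS hk0 hΦuc hΦu0 ht
  have hgc : TimeScale.RdContinuousOn Ts (TimeScale.kappa Ts) g :=
    .of_continuousOn (hk.continuousOn_volterra hS hk0 hkΔ0 hΦuc hΦu0)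
  -- `ω = Φ ∘ W`
  have hωc : ContinuousOn (fun x => Φ (W x)) (Set.Ici 0) := hΦc.comp hWc hW0
  have hωm : MonotoneOn (fun x => Φ (W x)) (Set.Ici 0) := fun x hx y hy hxy =>
    hΦm (hW0 x hx) (hW0 y hy) (hWm hx hy hxy)
  have hωpos : ∀ x, 0 < x → 0 < Φ (W x) := fun x hx => hΦpos _ (hWpos x hx)
  have hω0 : ∀ x, 0 ≤ x → 0 ≤ Φ (W x) := fun x hx => hΦ0 _ (hW0 x hx)
  have hωg : TimeScale.RdContinuousOn Ts Ts fun τ => Φ (W (g τ)) :=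
    hS.rdContinuousOn_of_kappa (hgc.comp (φ := fun x => Φ (W x)) hωc hg0)
  have hfWg : TimeScale.RdContinuousOn Ts Ts fun s => f s * W (g s) :=
    hS.rdContinuousOn_of_kappa (hf.mul (hgc.comp hWc hg0))
  set D : ℝ → ℝ := fun t => TimeScale.integral Ts (fun s => f s * W (g s)) a t with hD
  have hfWg0 : ∀ s ∈ TimeScale.kappa Ts, 0 ≤ f s * W (g s) := fun s hs =>
    mul_nonneg (hf0 s hs) (hW0 _ (hg0 s hs))
  have hDm : MonotoneOn D Ts := hS.integral_mono_right hfWg hfWg0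
  -- Grönwall's inequality
  have hup : ∀ t ∈ Ts, u t ≤ p t * (A t + D t) := fun t ht => by
    -- The constant is the value of the nondecreasing function `A + D` at the end point `t`.
    have := hS.gronwall hfT hf0 hu (c := A t + D t) ht fun s hs hst => by
      have h1 := hineq s hs
      have h2 := hAm hs ht hst.le
      have h3 := hDm hs ht hst.le
      change _ ≤ A s + _ + D s at h1
      linarith
    have h1 := hineq t ht
    change _ ≤ A t + _ + D t at h1
    rw [mul_comm]
    linarith
  -- Monotonicity of `g` and `W` lets `W (g t)` be pulled out of the integral.
  have hDF : ∀ t ∈ TimeScale.kappa Ts, D t ≤ W (g t) * F t := fun t ht => by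
    have hfc := hfT.mono (Set.inter_subset_left : TimeScale.interval Ts a t ⊆ Ts)
    rw [hF, ← hS.integral_const_mul _ ht.1 hfc]
    refine hS.integral_mono ht.1 (hfWg.mono Set.inter_subset_left) (hfc.const_mul _)
      fun s hs hst => ?_
    have hsκ := hS.mem_kappa_of_le ht hs hst.le
    rw [mul_comm]
    exact mul_le_mul_of_nonneg_right (hWm (hg0 s hsκ) (hg0 t ht) (hgm hsκ ht hst.le)) (hf0 s hsκ)
  have hΦu : ∀ τ ∈ TimeScale.kappa Ts, Φ (u τ) ≤ m τ + q τ * Φ (W (g τ)) := fun τ hτ => by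
    have hτT := hκ hτ
    have hWg := hW0 _ (hg0 τ hτ)
    have h1 : 0 ≤ p τ * F τ := mul_nonneg (hp0 τ hτT) (hF0 τ hτT)
    have h2 : u τ ≤ p τ * A τ + p τ * F τ * W (g τ) := by
      have := mul_le_mul_of_nonneg_left (hDF τ hτ) (hp0 τ hτT)
      linarith [hup τ hτT]
    have h3 := mul_nonneg h1 hWg
    calc Φ (u τ) ≤ Φ (p τ * A τ + p τ * F τ * W (g τ)) :=
          hΦm (hu0 τ hτT) (add_nonneg (hpA0 τ hτT) h3) h2
      _ ≤ m τ + Φ (p τ * F τ * W (g τ)) := hΦadd _ _ (hpA0 τ hτT) h3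
      _ ≤ m τ + Φ (p τ * F τ) * Φ (W (g τ)) := add_le_add_right (hΦmul _ _ h1 hWg) _
      _ ≤ m τ + q τ * Φ (W (g τ)) := add_le_add_right
          (mul_le_mul_of_nonneg_right (hΦmul _ _ (hp0 τ hτT) (hF0 τ hτT)) (hΦ0 _ hWg)) _
  -- Identify `ζ` and `I` with kernel integrals.
  have hζ : TimeScale.zeta Ts a b f A Φ k = TimeScale.volterra Ts a k m (TimeScale.rho Ts b) :=
    TimeScale.integral_congr (hS.least.2 hρκ.1) fun s hs _ _ => by
      rw [hm, hp, hS.pFun_eq hfT hf0 hs]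
  have hI : ∀ s ∈ Ts, TimeScale.kernelTerm Ts a f Φ k s = TimeScale.volterra Ts a k q s :=
    fun s hs => TimeScale.integral_congr (hS.least.2 hs) fun τ hτ _ _ => by
      rw [hS.pFun_eq hfT hf0 hτ, mul_assoc]
  set ζ := TimeScale.zeta Ts a b f A Φ k
  set I := TimeScale.kernelTerm Ts a f Φ k
  have hζ0 : 0 ≤ ζ := hζ ▸ hk.volterra_nonneg hS hk0 hmc hm0 hρκ
  have hIm : MonotoneOn I (TimeScale.kappa Ts) := fun s hs t ht hst => by
    rw [hI s hs.1, hI t ht.1]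
    exact hk.volterra_monotoneOn hS hk0 hkΔ0 hqc hq0 hs ht hst
  have hIc : ContinuousOn I (TimeScale.kappa Ts) :=
    (hk.continuousOn_volterra hS hk0 hkΔ0 hqc hq0).congr fun s hs => hI s hs.1
  have hIa : I a = 0 := (hI a hS.least.1).trans (TimeScale.IsDeltaKernel.volterra_least hS)
  have hgv : ∀ t ∈ TimeScale.kappa Ts,
      g t ≤ ζ + TimeScale.volterra Ts a k (fun τ => q τ * Φ (W (g τ))) t := fun t ht => by
    have h1 := hk.volterra_mono hS hk0 hΦuc (hmc.add (hqc.mul hωg)) ht fun τ hτ hτt =>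
      hΦu τ (hS.mem_kappa_of_le ht hτ hτt.le)
    rw [hk.volterra_add hS hmc (hqc.mul hωg) ht] at h1
    -- The integral of `m` up to `t` is at most the one up to `ρ(b)`, the maximum of `T^κ`, which is
    -- `ζ`.
    have h2 := hk.volterra_monotoneOn hS hk0 hkΔ0 hmc hm0 ht hρκ (hS.kappa_eq ▸ ht).2.2
    rw [← hζ] at h2
    linarith
  intro t ht hdom
  have hρt := hS.rho_mem_kappa ht
  have hsub : TimeScale.interval Ts a (TimeScale.rho Ts t) ⊆ TimeScale.kappa Ts := fun s hs =>
    hS.mem_kappa_of_le hρt hs.1 hs.2.2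
  -- Points up to `ρ(t)` suffice, because the final integral ignores its integrand at `t`.
  have key : ∀ s ∈ TimeScale.interval Ts a (TimeScale.rho Ts t),
      TimeScale.Psi Φ W x₀ ζ + I s ∈ TimeScale.domPsiInv Φ W x₀ ∧
      g s ≤ TimeScale.PsiInv Φ W x₀ (TimeScale.Psi Φ W x₀ ζ + I s) := by
    intro s hs
    have hsκ := hsub hs
    rcases hζ0.eq_or_lt with h0 | hpos
    -- Degenerate case `ζ = 0`: since `m ≥ Φ(A(a)) > 0`, both `g` and `I` vanish on `T^κ`. Then
    -- `Ψ(ζ) + I(s)` does not depend on `s` and lies in the domain by hypothesis, whatever value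
    -- `Ψ(0)` has; positivity of `Ψ⁻¹` concludes.
    · have hz : ∀ {w : ℝ → ℝ}, TimeScale.RdContinuousOn Ts Ts w →
          (∀ t ∈ TimeScale.kappa Ts, 0 ≤ w t) → ∀ {t}, t ∈ TimeScale.kappa Ts →
          TimeScale.volterra Ts a k w t = 0 := fun hw hw0 _ ht =>
        hk.volterra_eq_zero hS hk0 hkΔ0 (hΦpos _ (hApos a hS.least.1)) hmc
          (fun r hr => by
            have h1 := hAm hS.least.1 hr (hS.least.2 hr)
            have h2 := mul_le_mul_of_nonneg_right (hp1 r hr) (hApos r hr).le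
            exact hΦm (hApos a hS.least.1).le (hpA0 r hr) (by linarith))
          (hζ ▸ h0.symm) hw hw0 ht
      rw [hI _ hρt.1, hz hqc hq0 hρt] at hdom
      rw [hI s hs.1, hz hqc hq0 hsκ]
      exact ⟨hdom, (hz hΦuc hΦu0 hsκ).trans_le (TimeScale.PsiInv_pos hdom).le⟩
    -- The domain is an interval, and `Ψ(ζ) + I(s)` lies between `Ψ(ζ)` and `Ψ(ζ) + I(ρ(t))`.
    · have hd : TimeScale.Psi Φ W x₀ ζ + I s ∈ TimeScale.domPsiInv Φ W x₀ :=
        (TimeScale.ordConnected_domPsiInv hωc hωpos hx₀).out ⟨ζ, hpos, rfl⟩ hdom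
          ⟨by linarith [hIm haκ hsκ hs.2.1], by linarith [hIm hsκ hρt hs.2.2]⟩
      have hb := hk.bihari hS hk0 hkΔ0 hωc hωm hωpos hω0 hx₀ hpos hqc hq0 hωg hg0 hgv hsκ
      rw [← hI s hs.1] at hb
      have hv := hk.volterra_nonneg hS hk0 (hqc.mul hωg)
        (fun τ hτ => mul_nonneg (hq0 τ hτ) (hω0 _ (hg0 τ hτ))) hsκ
      exact ⟨hd, (hgv s hsκ).trans (TimeScale.le_PsiInv hωc hωpos hx₀ (by linarith) hd hb)⟩
  rw [hS.pFun_eq hfT hf0 ht, ← mul_add]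
  refine (hup t ht).trans (mul_le_mul_of_nonneg_left (add_le_add_right ?_ _) (hp0 t ht))
  have hθc : ContinuousOn (fun s => TimeScale.PsiInv Φ W x₀ (TimeScale.Psi Φ W x₀ ζ + I s))
      (TimeScale.interval Ts a (TimeScale.rho Ts t)) :=
    (TimeScale.continuousOn_PsiInv hωc hωpos hx₀).comp
      (continuousOn_const.add (hIc.mono hsub)) fun s hs => (key s hs).1
  -- If `t` is left-scattered, `Ψ(ζ) + I(t)` may leave the domain of `Ψ⁻¹`; rd-continuity on `[a,
  -- ρ(t)]` is still enough on `[a,t]`.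
  refine hS.integral_mono ht (hfWg.mono Set.inter_subset_left)
    (hS.rdContinuousOn_of_rho ht ((hf.mono hsub).mul
      ((TimeScale.RdContinuousOn.of_continuousOn hθc).comp hWc fun s hs =>
        (TimeScale.PsiInv_pos (key s hs).1).le))) fun s hs hst => ?_
  have hs' : s ∈ TimeScale.interval Ts a (TimeScale.rho Ts t) :=
    ⟨hs, hS.least.2 hs, TimeScale.le_rho hs hst⟩
  have hsκ := hsub hs'
  exact mul_le_mul_of_nonneg_left
    (hWm (hg0 s hsκ) (TimeScale.PsiInv_pos (key s hs').1).le (key s hs').2) (hf0 s hsκ)
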